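/- Let $p>q\ge 0$ be integers, let $A_1,\dots,A_p\in\mathbb R^{d\times d}$ and $B_0,\dots,B_q\in\mathbb R^{d\times m}$, and put $$A(\lambda)=I_d\lambda^p+A_1\lambda^{p-1}+\dots+A_p,\qquad B(\lambda)=B_0\lambda^q+\dots+B_q .$$ Let $L=(L(t))_{t\ge0}$ be an $\mathbb R^m$-valued L\'evy process: $L(0)=0$ a.s., stationary and independent increments, a.s. c\`adl\`ag paths. An $\mathbb R^d$-valued process $Y$ is called an MCARMA$(p,q)$ process (with polynomials $A,B$ and driving process $L$) if it solves the state space model $$Y(t)=C^*X(t),\qquad dX(t)=A^*X(t)\,dt+B^*\,dL(t),\qquad t\ge 0,$$ that is, if there is an $\mathbb R^{pd}$-valued c\`adl\`ag process $X$ such that almost surely, for all $t\ge0$, $Y(t)=C^*X(t)$ and $X(t)=X(0)+\int_0^tA^*X(s)\,ds+B^*(L(t)-L(0))$. Here $A^*\in\mathbb R^{pd\times pd}$ is the block companion matrix with identity blocks on the first block superdiagonal, last block row $(-A_p,-A_{p-1},\dots,-A_1)$ and zero blocks elsewhere; $C^*=(I_d,0,\dots,0)$; and $B^*=(\beta_1^{\mathsf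 T},\dots,\beta_p^{\mathsf T})^{\mathsf T}$ with $\beta_l=0$ for $1\le l\le p-q-1$ and $\beta_{p-j}=-\sum_{i=1}^{p-j-1}A_i\beta_{p-j-i}+B_{q-j}$ for $j=0,\dots,q$. A matrix $R\in\mathbb C^{d\times d}$ is a right solvent of $A(\lambda)$ if $R^p+A_1R^{p-1}+\dots+A_p=0$. It is regular if $\sigma(R)\cap\sigma(A^{(1)}(\cdot))=\emptyset$, where $A(\lambda)=A^{(1)}(\lambda)(\lambda I_d-R)$ and $\sigma(P(\cdot))=\{\lambda\in\mathbb C:\det P(\lambda)=0\}$. Right solvents $R_1,\dots,R_p$ form a complete set if $\sigma(A(\cdot))=\bigcup_{k=1}^p\sigma(R_k)$. Let $V(R_1,\dots,R_p)=(R_k^{\,i-1})_{i,k=1,\dots,p}\in\mathbb C^{pd\times pd}$ be the block Vandermonde matrix. Assume that $F(\lambda)=A(\lambda)^{-1}B(\lambda)$ is irreducible, i.e. $A(\lambda)$ and $B(\lambda)$ are left coprime (every common left divisor is unimodular), and that $R_1,\dots,R_p$ is a complete set of regular right solvents of $A(\lambda)$. For each $k$ let $$\operatorname{res}[F,R_k]=\frac1{2\pi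 i}\oint_{\Gamma_k}F(\lambda)\,d\lambda ,$$ where $\Gamma_k$ is any positively oriented simple closed contour with $\sigma(R_k)$ in its interior and $\sigma(A(\cdot))\setminus\sigma(R_k)$ in its exterior. For $k=1,\dots,p$ let $Y_k$ be the $\mathbb C^d$-valued Ornstein--Uhlenbeck process (in its c\`adl\`ag version) $$Y_k(t)=e^{R_kt}\,Y_k(0)+\int_0^te^{R_k(t-u)}\operatorname{res}[F,R_k]\,dL(u),\qquad t\ge0,$$ where the $\mathbb C^d$-valued random initial values are such that $V(R_1,\dots,R_p)\,(Y_1(0)^{\mathsf T},\dots,Y_p(0)^{\mathsf T})^{\mathsf T}\in\mathbb R^{pd}$ almost surely. Then $Y(t)=\sum_{k=1}^pY_k(t)$, $t\ge0$, is almost surely $\mathbb R^d$-valued and is a solution of the state space model above; that is, $Y$ is an MCARMA$(p,q)$ process with autoregressive polynomial $A(\lambda)$, moving average polynomial $B(\lambda)$ and driving process $L$. -/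

import Mathlib

open MeasureTheory ProbabilityTheory Filter Topology Polynomial
open scoped NNReal

namespace MCARMA

noncomputable section

/-! ## Matrix polynomials -/

/-- Entrywise embedding of real matrices into complex matrices. -/
def toC {m n : Type*} (M : Matrix m n ℝ) : Matrix m n ℂ :=
  M.map (fun x : ℝ => (x : ℂ))

/-- The value `P(z)` of a matrix polynomial (a matrix with polynomial entries). -/
def evalAt {m n : Type*} (P : Matrix m n ℂ[X]) (z : ℂ) : Matrix m n ℂ :=
  P.map (Polynomial.eval z)

/-- The autoregressive polynomial `A(λ) = I λ^p + A₁ λ^(p-1) + … + A_p`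
(only the values `A 1, …, A p` of the sequence `A` are used). -/
def arPoly (p : ℕ) {d : ℕ} (A : ℕ → Matrix (Fin d) (Fin d) ℝ) :
    Matrix (Fin d) (Fin d) ℂ[X] :=
  (X ^ p : ℂ[X]) • (1 : Matrix (Fin d) (Fin d) ℂ[X]) +
    ∑ i ∈ Finset.Icc 1 p, (X ^ (p - i) : ℂ[X]) • (toC (A i)).map Polynomial.C

/-- The moving average polynomial `B(λ) = B₀ λ^q + … + B_q`
(only the values `B 0, …, B q` of the sequence `B` are used). -/
def maPoly (q : ℕ) {d m : ℕ} (B : ℕ → Matrix (Fin d) (Fin m) ℝ) :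
    Matrix (Fin d) (Fin m) ℂ[X] :=
  ∑ j ∈ Finset.range (q + 1), (X ^ (q - j) : ℂ[X]) • (toC (B j)).map Polynomial.C

/-- `P` and `Q` are left coprime: each common left divisor is unimodular. -/
def LeftCoprime {d m : ℕ} (P : Matrix (Fin d) (Fin d) ℂ[X])
    (Q : Matrix (Fin d) (Fin m) ℂ[X]) : Prop :=
  ∀ (D P' : Matrix (Fin d) (Fin d) ℂ[X]) (Q' : Matrix (Fin d) (Fin m) ℂ[X]),
    P = D * P' → Q = D * Q' → IsUnit D

/-- The spectrum `σ(P(·)) = {z | det P(z) = 0}` of a square matrix polynomial. -/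
def polySpectrum {d : ℕ} (P : Matrix (Fin d) (Fin d) ℂ[X]) : Set ℂ :=
  {z | (evalAt P z).det = 0}

/-- The right matrix polynomial `A_R(Z) = Z^p + A₁ Z^(p-1) + … + A_p` of `A(λ)`. -/
def arRightEval (p : ℕ) {d : ℕ} (A : ℕ → Matrix (Fin d) (Fin d) ℝ)
    (Z : Matrix (Fin d) (Fin d) ℂ) : Matrix (Fin d) (Fin d) ℂ :=
  Z ^ p + ∑ i ∈ Finset.Icc 1 p, toC (A i) * Z ^ (p - i)

/-- `R` is a right solvent of `A(λ)`. -/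
def IsRightSolvent (p : ℕ) {d : ℕ} (A : ℕ → Matrix (Fin d) (Fin d) ℝ)
    (R : Matrix (Fin d) (Fin d) ℂ) : Prop :=
  arRightEval p A R = 0

/-- `R` is a regular right solvent of `A(λ)`: it is a right solvent, and in the factorization
`A(λ) = Q(λ) (λ I - R)` the spectra of `R` and of the cofactor `Q(λ)` are disjoint.
(The cofactor is unique, and automatically monic of degree `p - 1`;
`Matrix.charmatrix R` is `λ I - R`.) -/
def IsRegularRightSolvent (p : ℕ) {d : ℕ} (A : ℕ → Matrix (Fin d) (Fin d) ℝ)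
    (R : Matrix (Fin d) (Fin d) ℂ) : Prop :=
  IsRightSolvent p A R ∧
    ∃ Q : Matrix (Fin d) (Fin d) ℂ[X],
      arPoly p A = Q * R.charmatrix ∧ Disjoint (spectrum ℂ R) (polySpectrum Q)

/-- `R₁, …, R_p` is a complete set of regular right solvents of `A(λ)`. -/
def IsCompleteRegularSolvents (p : ℕ) {d : ℕ} (A : ℕ → Matrix (Fin d) (Fin d) ℝ)
    (R : Fin p → Matrix (Fin d) (Fin d) ℂ) : Prop :=
  (∀ k, IsRegularRightSolvent p A (R k)) ∧
    polySpectrum (arPoly p A) = ⋃ k, spectrum ℂ (R k)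

/-- The block Vandermonde matrix `V(R₁, …, R_p)`, with blocks `R_k ^ i`, `0 ≤ i < p`. -/
def blockVandermonde {p d : ℕ} (R : Fin p → Matrix (Fin d) (Fin d) ℂ) :
    Matrix (Fin p × Fin d) (Fin p × Fin d) ℂ :=
  Matrix.of fun r c => ((R c.1) ^ (r.1 : ℕ)) r.2 c.2

/-! ## Residues at solvents -/

/-- A (rectifiable) simple closed contour in `ℂ`, parametrized by `[0,1]`: a continuous closed
curve without self-intersections that is differentiable off a finite set, with integrable
derivative. All piecewise `C¹` simple closed curves are of this kind. -/
structure SimpleClosedContour where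
  γ : ℝ → ℂ
  continuousOn : ContinuousOn γ (Set.Icc 0 1)
  closed : γ 0 = γ 1
  simple : Set.InjOn γ (Set.Ico 0 1)
  differentiable : ∃ s : Set ℝ, s.Finite ∧ ∀ t ∈ Set.Ioo (0 : ℝ) 1 \ s, DifferentiableAt ℝ γ t
  integrable : IntervalIntegrable (deriv γ) volume 0 1

/-- The contour integral `∮_Γ f(z) dz`. -/
def SimpleClosedContour.integral (Γ : SimpleClosedContour) (f : ℂ → ℂ) : ℂ :=
  ∫ t in (0 : ℝ)..1, f (Γ.γ t) * deriv Γ.γ t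

/-- The winding number of the contour around `a`. -/
def SimpleClosedContour.windingNumber (Γ : SimpleClosedContour) (a : ℂ) : ℂ :=
  (2 * Real.pi * Complex.I)⁻¹ * Γ.integral (fun z => (z - a)⁻¹)

/-- The interior of a positively oriented simple closed contour. -/
def SimpleClosedContour.interior (Γ : SimpleClosedContour) : Set ℂ :=
  {a | a ∉ Γ.γ '' Set.Icc 0 1 ∧ Γ.windingNumber a = 1}

/-- The exterior of a simple closed contour. -/
def SimpleClosedContour.exterior (Γ : SimpleClosedContour) : Set ℂ :=
  {a | a ∉ Γ.γ '' Set.Icc 0 1 ∧ Γ.windingNumber a = 0}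

/-- The rational matrix function `F(λ) = P(λ)⁻¹ Q(λ)`. -/
def ratFun {d m : ℕ} (P : Matrix (Fin d) (Fin d) ℂ[X]) (Q : Matrix (Fin d) (Fin m) ℂ[X])
    (z : ℂ) : Matrix (Fin d) (Fin m) ℂ :=
  (evalAt P z)⁻¹ * evalAt Q z

/-- `Γ` is a contour that may be used for the residue of `P(λ)⁻¹ Q(λ)` at the solvent `R` of `P`:
`σ(R)` lies in its interior and `σ(P(·)) \ σ(R)` in its exterior. -/
def IsResidueContour {d : ℕ} (P : Matrix (Fin d) (Fin d) ℂ[X])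
    (R : Matrix (Fin d) (Fin d) ℂ) (Γ : SimpleClosedContour) : Prop :=
  spectrum ℂ R ⊆ Γ.interior ∧ polySpectrum P \ spectrum ℂ R ⊆ Γ.exterior

/-- The matrix `(1 / 2πi) ∮_Γ F(z) dz`, which is the residue `res[F, R]`
when `Γ` is a residue contour for `R`. -/
def residueAlong {d m : ℕ} (F : ℂ → Matrix (Fin d) (Fin m) ℂ) (Γ : SimpleClosedContour) :
    Matrix (Fin d) (Fin m) ℂ :=
  Matrix.of fun i j => (2 * Real.pi * Complex.I)⁻¹ * Γ.integral (fun z => F z i j)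

/-! ## Processes, Lévy processes and integrals of deterministic functions -/

variable {Ω : Type*} [MeasurableSpace Ω]

/-- A function on `[0, ∞)` is càdlàg. -/
def IsCadlag {E : Type*} [TopologicalSpace E] (x : ℝ≥0 → E) : Prop :=
  ∀ t, ContinuousWithinAt x (Set.Ioi t) t ∧ ∃ l, Tendsto x (𝓝[<] t) (𝓝 l)

/-- A stochastic process with (almost surely) càdlàg sample paths. -/
def IsCadlagProcess {E : Type*} [TopologicalSpace E] [MeasurableSpace E]
    (μ : Measure Ω) (Z : ℝ≥0 → Ω → E) : Prop :=
  (∀ t, Measurable (Z t)) ∧ ∀ᵐ ω ∂μ, IsCadlag (fun t => Z t ω)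

/-- An `ℝ^m`-valued Lévy process. -/
structure IsLevyProcess {m : ℕ} (μ : Measure Ω) (L : ℝ≥0 → Ω → (Fin m → ℝ)) : Prop where
  cadlag : IsCadlagProcess μ L
  zero : ∀ᵐ ω ∂μ, L 0 ω = 0
  indep : HasIndepIncrements L μ
  stationary : ∀ s h : ℝ≥0,
    IdentDistrib (fun ω => L (s + h) ω - L s ω) (fun ω => L h ω - L 0 ω) μ μ

/-- A partition `0 = t₀ ≤ t₁ ≤ … ≤ t_N = t` of `[0, t]`. -/
structure TimePartition (t : ℝ≥0) where
  N : ℕ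
  pts : ℕ → ℝ≥0
  mono : Monotone pts
  first : pts 0 = 0
  last : pts N = t

/-- The mesh of a partition. -/
def TimePartition.mesh {t : ℝ≥0} (π : TimePartition t) : ℝ≥0 :=
  (Finset.range π.N).sup fun i => π.pts (i + 1) - π.pts i

/-- The Riemann sum `∑ f(t_i) (L(t_{i+1}) - L(t_i))`. -/
def stochSum {d m : ℕ} (f : ℝ≥0 → Matrix (Fin d) (Fin m) ℂ) (L : ℝ≥0 → Ω → (Fin m → ℝ))
    {t : ℝ≥0} (π : TimePartition t) (ω : Ω) : Fin d → ℂ :=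
  ∑ i ∈ Finset.range π.N,
    (f (π.pts i)).mulVec (fun j => ((L (π.pts (i + 1)) ω j - L (π.pts i) ω j : ℝ) : ℂ))

/-- `I` is the stochastic integral `∫₀ᵗ f(u) dL(u)` of the deterministic continuous function `f`:
the limit in probability of the Riemann sums along each sequence of partitions of `[0, t]`
whose mesh tends to zero. This determines `I` up to almost sure equality. -/
def IsStochIntegral {d m : ℕ} (μ : Measure Ω) (f : ℝ≥0 → Matrix (Fin d) (Fin m) ℂ)
    (L : ℝ≥0 → Ω → (Fin m → ℝ)) (t : ℝ≥0) (I : Ω → (Fin d → ℂ)) : Prop :=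
  ∀ π : ℕ → TimePartition t, Tendsto (fun n => (π n).mesh) atTop (𝓝 0) →
    TendstoInMeasure μ (fun n => stochSum f L (π n)) atTop I

open Classical in
/-- The stochastic integral `∫₀ᵗ f(u) dL(u)` (zero if it does not exist). -/
def stochIntegral {d m : ℕ} (μ : Measure Ω) (f : ℝ≥0 → Matrix (Fin d) (Fin m) ℂ)
    (L : ℝ≥0 → Ω → (Fin m → ℝ)) (t : ℝ≥0) : Ω → (Fin d → ℂ) :=
  if h : ∃ I, IsStochIntegral μ f L t I then h.choose else 0

/-- `Z` is the complex Ornstein-Uhlenbeck process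
`Z(t) = e^(Rt) Z(0) + ∫₀ᵗ e^(R(t-u)) G dL(u)`, in its càdlàg version. -/
def IsOrnsteinUhlenbeck {d m : ℕ} (μ : Measure Ω) (R : Matrix (Fin d) (Fin d) ℂ)
    (G : Matrix (Fin d) (Fin m) ℂ) (L : ℝ≥0 → Ω → (Fin m → ℝ))
    (Z : ℝ≥0 → Ω → (Fin d → ℂ)) : Prop :=
  IsCadlagProcess μ Z ∧
    ∀ t : ℝ≥0, ∀ᵐ ω ∂μ, Z t ω =
      (NormedSpace.exp (((t : ℝ) : ℂ) • R)).mulVec (Z 0 ω) +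
        stochIntegral μ (fun u => NormedSpace.exp ((((t : ℝ) - (u : ℝ) : ℝ) : ℂ) • R) * G) L t ω

/-! ## The state space model -/

/-- The block companion matrix `A*`. -/
def stateA (p : ℕ) {d : ℕ} (A : ℕ → Matrix (Fin d) (Fin d) ℝ) :
    Matrix (Fin p × Fin d) (Fin p × Fin d) ℝ :=
  Matrix.of fun r c =>
    if (r.1 : ℕ) + 1 = p then -(A (p - (c.1 : ℕ)) r.2 c.2)
    else if (c.1 : ℕ) = (r.1 : ℕ) + 1 then (1 : Matrix (Fin d) (Fin d) ℝ) r.2 c.2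
    else 0

/-- The blocks `β_l` of `B*`: `β_l = 0` for `l < p - q`, and
`β_l = - ∑_{i=1}^{l-1} A_i β_{l-i} + B_{q-p+l}` for `p - q ≤ l ≤ p`. -/
def stateBeta (p q : ℕ) {d m : ℕ} (A : ℕ → Matrix (Fin d) (Fin d) ℝ)
    (B : ℕ → Matrix (Fin d) (Fin m) ℝ) (l : ℕ) : Matrix (Fin d) (Fin m) ℝ :=
  if l < p - q then 0
  else -(∑ i : Fin (l - 1), A ((i : ℕ) + 1) * stateBeta p q A B (l - ((i : ℕ) + 1)))
    + B (l - (p - q))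
termination_by l
decreasing_by have := i.isLt; omega

/-- The matrix `B* = (β₁ᵀ ⋯ β_pᵀ)ᵀ`. -/
def stateB (p q : ℕ) {d m : ℕ} (A : ℕ → Matrix (Fin d) (Fin d) ℝ)
    (B : ℕ → Matrix (Fin d) (Fin m) ℝ) : Matrix (Fin p × Fin d) (Fin m) ℝ :=
  Matrix.of fun r c => stateBeta p q A B ((r.1 : ℕ) + 1) r.2 c

/-- The matrix `C* = (I, 0, …, 0)`. -/
def stateC (p d : ℕ) : Matrix (Fin d) (Fin p × Fin d) ℝ :=
  Matrix.of fun a c => if (c.1 : ℕ) = 0 then (1 : Matrix (Fin d) (Fin d) ℝ) a c.2 else 0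

/-- `Y` is an `ℝ^d`-valued solution of the state space model
`Y(t) = C* X(t)`, `dX(t) = A* X(t) dt + B* dL(t)`, `t ≥ 0`, that is, an `MCARMA(p,q)` process
with autoregressive polynomial `A(λ)`, moving average polynomial `B(λ)` and driving process `L`.
The state equation is understood in integrated form. -/
def IsMCARMA (p q : ℕ) {d m : ℕ} (A : ℕ → Matrix (Fin d) (Fin d) ℝ)
    (B : ℕ → Matrix (Fin d) (Fin m) ℝ) (μ : Measure Ω) (L : ℝ≥0 → Ω → (Fin m → ℝ))
    (Y : ℝ≥0 → Ω → (Fin d → ℝ)) : Prop :=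
  ∃ X : ℝ≥0 → Ω → (Fin p × Fin d → ℝ),
    IsCadlagProcess μ X ∧
    ∀ᵐ ω ∂μ, ∀ t : ℝ≥0,
      Y t ω = (stateC p d).mulVec (X t ω) ∧
      X t ω = X 0 ω + (∫ s in (0 : ℝ)..t, (stateA p A).mulVec (X s.toNNReal ω)) +
        (stateB p q A B).mulVec (L t ω - L 0 ω)

end

end MCARMA

/-! Put `X = V(R₁, …, R_p) (Y₁, …, Y_p)ᵀ`, whose `i`-th block, counting from zero, is `∑ R_k^i Y_k`;
its block zero is `Y = ∑ Y_k`. The claim is that `X` is real and solves the state equation, and the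
argument runs path by path.

Summation by parts turns the stochastic integral into a Lebesgue integral of the path of `L`. Each
`Y_k` then satisfies the Langevin equation `Y_k(t) = Y_k(0) + ∫₀ᵗ R_k Y_k ds + res[F, R_k] (L(t) -
L(0))` on one almost sure event for all `t` (`IsOrnsteinUhlenbeck.ae_eq_add_integral`).

Multiplying by `V` gives the state equation, thanks to two algebraic identities. The first is `A* V
= V diag(R_k)`, the solvent equation read in the last block row
(`stateA_mul_blockVandermonde_apply`). The second is `∑ R_k^i res[F, R_k] = β_{i+1}` for `i < p`,
that is, `V` maps the stacked residues to `B*` (`sum_pow_mul_residueAlong`).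

The second identity is a residue computation at infinity. By regularity, `R_k^i res[F, R_k]` is the
contour integral of `λ^i F(λ)` around `σ(R_k)` (`pow_mul_residueAlong_apply`). The spectra of the
solvents are pairwise disjoint by a count of multiplicities
(`disjoint_spectrum_of_isCompleteRegularSolvents`), so the sum over `k` collects every residue of
`λ^i F(λ)` exactly once. That total is the coefficient of `λ⁻¹` at infinity (`exists_residues`), and
the recursion for `β` makes it `β_{i+1}` (`coeff_modByMonic_det_arPoly`). Interior and exterior are
given by winding numbers, so partial fractions suffice for the residue theorem.

Finally, `A*`, `B*` and `L` are real, so `Im X` solves `z(t) = ∫₀ᵗ A* z ds` with zero initial value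
and vanishes by Gronwall's inequality. -/

namespace MCARMA

noncomputable section

/-! ## Contour integrals of rational functions -/

namespace SimpleClosedContour

variable (Γ : SimpleClosedContour)

lemma intervalIntegrable {f : ℂ → ℂ} (hf : ContinuousOn f (Γ.γ '' Set.Icc 0 1)) :
    IntervalIntegrable (fun t => f (Γ.γ t) * deriv Γ.γ t) volume 0 1 := by
  refine Γ.integrable.continuousOn_mul ?_
  rw [Set.uIcc_of_le zero_le_one]
  exact hf.comp Γ.continuousOn (Set.mapsTo_image _ _)

lemma integral_eq_zero_of_hasDerivAt {f g : ℂ → ℂ} (hf : ContinuousOn f (Γ.γ '' Set.Icc 0 1))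
    (hg : ∀ z ∈ Γ.γ '' Set.Icc 0 1, HasDerivAt g (f z) z) : Γ.integral f = 0 := by
  obtain ⟨s, hs, hd⟩ := Γ.differentiable
  have hc : ContinuousOn g (Γ.γ '' Set.Icc 0 1) :=
    fun z hz => (hg z hz).continuousAt.continuousWithinAt
  have := integral_eq_of_hasDerivAt_off_countable_of_le (fun t => g (Γ.γ t))
    (fun t => f (Γ.γ t) * deriv Γ.γ t) zero_le_one hs.countable
    (hc.comp Γ.continuousOn (Set.mapsTo_image _ _))
    (fun t ht => (hg _ ⟨t, Set.Ioo_subset_Icc_self ht.1, rfl⟩).comp t (hd t ht).hasDerivAt)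
    (Γ.intervalIntegrable hf)
  rw [integral, this, Γ.closed, sub_self]

lemma integral_add {f g : ℂ → ℂ} (hf : ContinuousOn f (Γ.γ '' Set.Icc 0 1))
    (hg : ContinuousOn g (Γ.γ '' Set.Icc 0 1)) :
    Γ.integral (fun z => f z + g z) = Γ.integral f + Γ.integral g := by
  simp only [integral, add_mul]
  exact intervalIntegral.integral_add (Γ.intervalIntegrable hf) (Γ.intervalIntegrable hg)

lemma integral_sum {ι : Type*} (s : Finset ι) {f : ι → ℂ → ℂ}
    (hf : ∀ i ∈ s, ContinuousOn (f i) (Γ.γ '' Set.Icc 0 1)) :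
    Γ.integral (fun z => ∑ i ∈ s, f i z) = ∑ i ∈ s, Γ.integral (f i) := by
  simp only [integral, Finset.sum_mul]
  exact intervalIntegral.integral_finsetSum fun i hi => Γ.intervalIntegrable (hf i hi)

lemma integral_const_mul (c : ℂ) (f : ℂ → ℂ) :
    Γ.integral (fun z => c * f z) = c * Γ.integral f := by
  simp only [integral, mul_assoc]
  exact intervalIntegral.integral_const_mul _ _

lemma integral_congr {f g : ℂ → ℂ} (h : ∀ z ∈ Γ.γ '' Set.Icc 0 1, f z = g z) :
    Γ.integral f = Γ.integral g := by
  refine intervalIntegral.integral_congr fun t ht => ?_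
  rw [Set.uIcc_of_le zero_le_one] at ht
  simp only [h _ ⟨t, ht, rfl⟩]

lemma integral_polynomial (P : ℂ[X]) : Γ.integral (fun z => P.eval z) = 0 := by
  have hmon : ∀ n : ℕ, Γ.integral (fun z => z ^ n) = 0 := fun n => by
    refine Γ.integral_eq_zero_of_hasDerivAt (g := fun z => z ^ (n + 1) / (n + 1))
      (by fun_prop) fun z _ => ?_
    have h := (hasDerivAt_pow (n + 1) z).div_const ((n : ℂ) + 1)
    have hn : (n : ℂ) + 1 ≠ 0 := by exact_mod_cast n.succ_ne_zero
    convert! h using 1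
    push_cast
    field_simp
  simp_rw [Polynomial.eval_eq_sum_range]
  rw [Γ.integral_sum _ fun i _ => by fun_prop]
  exact Finset.sum_eq_zero fun i _ => by rw [Γ.integral_const_mul, hmon, mul_zero]

lemma continuousOn_inv_sub_pow {a : ℂ} (ha : a ∉ Γ.γ '' Set.Icc 0 1) (n : ℕ) :
    ContinuousOn (fun z => ((z - a) ^ n)⁻¹) (Γ.γ '' Set.Icc 0 1) := by
  refine ContinuousOn.inv₀ (by fun_prop) fun z hz => pow_ne_zero _ (sub_ne_zero.2 ?_)
  rintro rfl
  exact ha hz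

/-- Only the simple pole lacks a primitive near the contour; a higher power `(z - a)^(-(n+1))`
integrates to zero along a closed curve. -/
lemma integral_inv_sub_pow {a : ℂ} (ha : a ∉ Γ.γ '' Set.Icc 0 1) (n : ℕ) :
    (2 * Real.pi * Complex.I)⁻¹ * Γ.integral (fun z => ((z - a) ^ (n + 1))⁻¹) =
      if n = 0 then Γ.windingNumber a else 0 := by
  split_ifs with hn
  · simp [hn, windingNumber]
  · refine mul_eq_zero_of_right _ (Γ.integral_eq_zero_of_hasDerivAt
      (g := fun z => -((n : ℂ)⁻¹ * ((z - a) ^ n)⁻¹)) (Γ.continuousOn_inv_sub_pow ha _)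
      fun z hz => ?_)
    have hz' : z - a ≠ 0 := sub_ne_zero.2 (by rintro rfl; exact ha hz)
    have h := ((((hasDerivAt_id z).sub_const a).pow n).inv (pow_ne_zero n hz')).const_mul
      ((n : ℂ)⁻¹) |>.neg
    convert! h using 1
    obtain ⟨k, rfl⟩ := Nat.exists_eq_succ_of_ne_zero hn
    have hn : (k : ℂ) + 1 ≠ 0 := by exact_mod_cast k.succ_ne_zero
    simp
    field_simp
    ring

end SimpleClosedContour

/-- Partial fractions of `N / D`, cleared of denominators: the `(a, j)` term is a constant times `D
/ (X - a)^(mult a - j)`, where `mult a` is the multiplicity of the root `a`. -/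
lemma exists_partialFractions (N D : ℂ[X]) (hD : D.Monic) :
    ∃ (q : ℂ[X]) (c : ℂ → ℕ → ℂ), N = q * D + ∑ a ∈ D.roots.toFinset,
      ∑ j ∈ Finset.range (D.roots.count a), C (c a j) *
        ((X - C a) ^ j * ∏ b ∈ D.roots.toFinset.erase a, (X - C b) ^ D.roots.count b) := by
  classical
  obtain ⟨q, r, hr, hN⟩ := eq_quo_mul_prod_pow_add_sum_rem_mul_prod_pow
    (s := D.roots.toFinset) N (g := fun a => X - C a) (fun a _ => monic_X_sub_C a)
    (fun a _ b _ hab => isCoprime_X_sub_C_of_isUnit_sub (sub_ne_zero.2 hab).isUnit)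
    (fun a => D.roots.count a)
  have hprod : ∏ a ∈ D.roots.toFinset, (X - C a) ^ D.roots.count a = D := by
    rw [← Finset.prod_multiset_map_count]
    exact (IsAlgClosed.splits D).eq_prod_roots_of_monic hD |>.symm
  -- The remainders have degree below that of `X - a`, hence are constants; the value outside the
  -- range of `j` is never used.
  refine ⟨q, fun a j => if h : j < D.roots.count a then (r a ⟨j, h⟩).coeff 0 else 0, ?_⟩
  conv_lhs => rw [hN, hprod]
  congr 1
  refine Finset.sum_congr rfl fun a ha => ?_
  rw [Finset.sum_range]
  refine Finset.sum_congr rfl fun j _ => ?_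
  have h := hr a ha j
  rw [degree_X_sub_C] at h
  simp only
  rw [dif_pos j.2, mul_assoc, ← eq_C_of_degree_le_zero (Nat.WithBot.lt_one_iff_le_zero.1 h)]

/-- The residue theorem for the rational function `N / D`: the residues `r a` at the zeros of `D`
sum up to the coefficient of `1 / z` in the expansion of `N / D` at infinity. -/
lemma exists_residues (N D : ℂ[X]) (hD : D.Monic) :
    ∃ r : ℂ → ℂ,
      (∀ Γ : SimpleClosedContour, (∀ a ∈ D.roots, a ∉ Γ.γ '' Set.Icc 0 1) →
        (2 * Real.pi * Complex.I)⁻¹ * Γ.integral (fun z => N.eval z / D.eval z) =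
          ∑ a ∈ D.roots.toFinset, r a * Γ.windingNumber a) ∧
      ∀ n, n + 1 = D.natDegree → ∑ a ∈ D.roots.toFinset, r a = (N %ₘ D).coeff n := by
  classical
  obtain ⟨q, c, hN⟩ := exists_partialFractions N D hD
  have hprod : ∏ a ∈ D.roots.toFinset, (X - C a) ^ D.roots.count a = D := by
    rw [← Finset.prod_multiset_map_count]
    exact (IsAlgClosed.splits D).eq_prod_roots_of_monic hD |>.symm
  set E : ℂ → ℕ → ℂ[X] := fun a j =>
    (X - C a) ^ j * ∏ b ∈ D.roots.toFinset.erase a, (X - C b) ^ D.roots.count b with hE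
  -- The pole order `mult a - j` is written as `mult a - 1 - j + 1` so that `integral_inv_sub_pow`
  -- applies, with the simple pole at `j = mult a - 1`.
  have hED : ∀ a ∈ D.roots.toFinset, ∀ j < D.roots.count a,
      (X - C a) ^ (D.roots.count a - 1 - j + 1) * E a j = D := fun a ha j hj => by
    rw [hE]
    simp only
    rw [← mul_assoc, ← pow_add, show D.roots.count a - 1 - j + 1 + j = D.roots.count a by omega,
      Finset.mul_prod_erase _ (fun b => (X - C b) ^ D.roots.count b) ha, hprod]
  have hEm : ∀ a j, (E a j).Monic := fun a j =>
    ((monic_X_sub_C a).pow j).mul (monic_prod_of_monic _ _ fun b _ => (monic_X_sub_C b).pow _)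
  have hEd : ∀ a ∈ D.roots.toFinset, ∀ j < D.roots.count a,
      (E a j).natDegree + (D.roots.count a - 1 - j + 1) = D.natDegree := fun a ha j hj => by
    have h := congrArg natDegree (hED a ha j hj)
    rw [((monic_X_sub_C a).pow _).natDegree_mul (hEm a j), natDegree_pow, natDegree_X_sub_C] at h
    omega
  -- The sum merely selects the coefficient `c a j` of the simple pole. The same `j` is the only one
  -- for which `E a j` reaches degree `deg D - 1`, which yields both assertions.
  refine ⟨fun a => ∑ j ∈ Finset.range (D.roots.count a),
    if D.roots.count a - 1 - j = 0 then c a j else 0, fun Γ hΓ => ?_, fun n hn => ?_⟩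
  · have hne : ∀ z ∈ Γ.γ '' Set.Icc 0 1, D.eval z ≠ 0 := fun z hz h0 =>
      hΓ z ((mem_roots hD.ne_zero).2 h0) hz
    have hfun : ∀ z ∈ Γ.γ '' Set.Icc 0 1, N.eval z / D.eval z = q.eval z +
        ∑ a ∈ D.roots.toFinset, ∑ j ∈ Finset.range (D.roots.count a),
          c a j * ((z - a) ^ (D.roots.count a - 1 - j + 1))⁻¹ := fun z hz => by
      rw [hN, eval_add, eval_mul, add_div, mul_div_cancel_right₀ _ (hne z hz), eval_finsetSum,
        Finset.sum_div]
      congr 1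
      refine Finset.sum_congr rfl fun a ha => ?_
      rw [eval_finsetSum, Finset.sum_div]
      refine Finset.sum_congr rfl fun j hj => ?_
      have h := congrArg (eval z) (hED a ha j (Finset.mem_range.1 hj))
      rw [eval_mul] at h
      have hn := hne z hz
      rw [← h] at hn ⊢
      rw [eval_mul, eval_C, mul_div_assoc, div_mul_cancel_right₀ (right_ne_zero_of_mul hn)]
      simp
    have hmem : ∀ a ∈ D.roots.toFinset, a ∉ Γ.γ '' Set.Icc 0 1 :=
      fun a ha => hΓ a (Multiset.mem_toFinset.1 ha)
    have hcont : ∀ a ∈ D.roots.toFinset, ∀ j, ContinuousOn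
        (fun z => c a j * ((z - a) ^ (D.roots.count a - 1 - j + 1))⁻¹) (Γ.γ '' Set.Icc 0 1) :=
      fun a ha j => continuousOn_const.mul (Γ.continuousOn_inv_sub_pow (hmem a ha) _)
    rw [Γ.integral_congr hfun, Γ.integral_add (by fun_prop)
      (continuousOn_finsetSum _ fun a ha => continuousOn_finsetSum _ fun j _ => hcont a ha j),
      Γ.integral_polynomial, zero_add, Γ.integral_sum _
      fun a ha => continuousOn_finsetSum _ fun j _ => hcont a ha j, Finset.mul_sum]
    refine Finset.sum_congr rfl fun a ha => ?_
    rw [Γ.integral_sum _ fun j _ => hcont a ha j, Finset.mul_sum, Finset.sum_mul]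
    refine Finset.sum_congr rfl fun j _ => ?_
    rw [Γ.integral_const_mul, mul_left_comm, Γ.integral_inv_sub_pow (hmem a ha)]
    split_ifs <;> simp
  · have hlt : (∑ a ∈ D.roots.toFinset, ∑ j ∈ Finset.range (D.roots.count a),
        C (c a j) * E a j).degree < D.degree := by
      refine lt_of_le_of_lt (b := (n : WithBot ℕ)) ?_ ?_
      · refine (degree_sum_le _ _).trans (Finset.sup_le fun a ha => ?_)
        refine (degree_sum_le _ _).trans (Finset.sup_le fun j hj => ?_)
        refine degree_le_of_natDegree_le ((natDegree_C_mul_le _ _).trans ?_)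
        have := hEd a ha j (Finset.mem_range.1 hj)
        omega
      · rw [degree_eq_natDegree hD.ne_zero, ← hn]
        exact_mod_cast n.lt_succ_self
    have hmod : N %ₘ D = ∑ a ∈ D.roots.toFinset, ∑ j ∈ Finset.range (D.roots.count a),
        C (c a j) * E a j :=
      (div_modByMonic_unique q _ hD ⟨by rw [hN]; ring, hlt⟩).2
    rw [hmod, finsetSum_coeff]
    refine Finset.sum_congr rfl fun a ha => ?_
    rw [finsetSum_coeff]
    refine Finset.sum_congr rfl fun j hj => ?_
    have h := hEd a ha j (Finset.mem_range.1 hj)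
    rw [coeff_C_mul]
    split_ifs with h0
    · rw [show n = (E a j).natDegree by omega, (hEm a j).coeff_natDegree, mul_one]
    · rw [coeff_eq_zero_of_natDegree_lt (by omega), mul_zero]

/-! ## Matrix polynomials -/

lemma evalAt_eq_mapMatrix {d : ℕ} (P : Matrix (Fin d) (Fin d) ℂ[X]) (z : ℂ) :
    evalAt P z = (evalRingHom z).mapMatrix P := rfl

lemma det_evalAt {d : ℕ} (P : Matrix (Fin d) (Fin d) ℂ[X]) (z : ℂ) :
    (evalAt P z).det = P.det.eval z := by
  rw [evalAt_eq_mapMatrix, ← RingHom.map_det, coe_evalRingHom]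

lemma mem_polySpectrum {d : ℕ} {P : Matrix (Fin d) (Fin d) ℂ[X]} {z : ℂ} :
    z ∈ polySpectrum P ↔ P.det.IsRoot z := by
  rw [polySpectrum, Set.mem_ofPred_eq, det_evalAt, IsRoot]

lemma evalAt_mul {l m n : Type*} [Fintype m] (P : Matrix l m ℂ[X]) (Q : Matrix m n ℂ[X]) (z : ℂ) :
    evalAt (P * Q) z = evalAt P z * evalAt Q z :=
  Matrix.map_mul (f := evalRingHom z)

lemma ratFun_apply {d m : ℕ} (P : Matrix (Fin d) (Fin d) ℂ[X]) (Q : Matrix (Fin d) (Fin m) ℂ[X])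
    (z : ℂ) (i : Fin d) (j : Fin m) :
    ratFun P Q z i j = ((P.adjugate * Q) i j).eval z / P.det.eval z := by
  have h : evalAt P.adjugate z = (evalAt P z).adjugate := by
    rw [evalAt_eq_mapMatrix, evalAt_eq_mapMatrix, RingHom.map_adjugate]
  have h2 : ((P.adjugate * Q) i j).eval z = ((evalAt P z).adjugate * evalAt Q z) i j := by
    rw [← h, ← evalAt_mul]; rfl
  rw [ratFun, Matrix.inv_def, det_evalAt, h2, Matrix.smul_mul, Matrix.smul_apply, smul_eq_mul,
    Ring.inverse_eq_inv', div_eq_inv_mul]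

lemma coeff_arPoly (p : ℕ) {d : ℕ} (A : ℕ → Matrix (Fin d) (Fin d) ℝ) (i j : Fin d) (k : ℕ) :
    (arPoly p A i j).coeff k =
      (if k = p then (1 : Matrix (Fin d) (Fin d) ℂ) else if k < p then toC (A (p - k)) else 0)
        i j := by
  have h1 : ((1 : Matrix (Fin d) (Fin d) ℂ[X]) i j) = C ((1 : Matrix (Fin d) (Fin d) ℂ) i j) := by
    simp [Matrix.one_apply, apply_ite C]
  simp only [arPoly, Matrix.add_apply, Matrix.smul_apply, Matrix.sum_apply, Matrix.map_apply,
    smul_eq_mul, coeff_add, finsetSum_coeff, h1, coeff_mul_C, coeff_X_pow, ite_mul, one_mul,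
    zero_mul]
  rcases lt_trichotomy k p with h | h | h
  · rw [if_neg h.ne, if_neg h.ne, if_pos h, zero_add, Finset.sum_eq_single (p - k),
      if_pos (by omega)]
    · intro b hb hbk
      rw [Finset.mem_Icc] at hb
      rw [if_neg (by omega)]
    · intro hb
      exact absurd (Finset.mem_Icc.2 ⟨by omega, by omega⟩) hb
  · rw [if_pos h, if_pos h, Finset.sum_eq_zero, add_zero]
    intro b hb
    rw [Finset.mem_Icc] at hb
    rw [if_neg (by omega)]
  · rw [if_neg h.ne', if_neg h.ne', if_neg h.not_gt, zero_add, Finset.sum_eq_zero,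
      Matrix.zero_apply]
    intro b hb
    rw [Finset.mem_Icc] at hb
    rw [if_neg (by omega)]

lemma coeff_maPoly (q : ℕ) {d m : ℕ} (B : ℕ → Matrix (Fin d) (Fin m) ℝ) (i : Fin d) (j : Fin m)
    (k : ℕ) : (maPoly q B i j).coeff k = (if k ≤ q then toC (B (q - k)) else 0) i j := by
  simp only [maPoly, Matrix.smul_apply, Matrix.sum_apply, Matrix.map_apply, smul_eq_mul,
    finsetSum_coeff, coeff_mul_C, coeff_X_pow, ite_mul, one_mul, zero_mul]
  split_ifs with h
  · rw [Finset.sum_eq_single (q - k), if_pos (by omega)]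
    · intro b hb hbk
      rw [Finset.mem_range] at hb
      rw [if_neg (by omega)]
    · intro hb
      exact absurd (Finset.mem_range.2 (by omega)) hb
  · rw [Finset.sum_eq_zero, Matrix.zero_apply]
    intro b hb
    rw [if_neg (by omega)]

lemma natDegree_arPoly_le (p : ℕ) {d : ℕ} (A : ℕ → Matrix (Fin d) (Fin d) ℝ) (i j : Fin d) :
    (arPoly p A i j).natDegree ≤ p := by
  refine natDegree_le_iff_coeff_eq_zero.2 fun k hk => ?_
  rw [coeff_arPoly, if_neg (by omega), if_neg (by omega), Matrix.zero_apply]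

lemma natDegree_det_le_mul {d e : ℕ} (M : Matrix (Fin d) (Fin d) ℂ[X])
    (h : ∀ i j, (M i j).natDegree ≤ e) : M.det.natDegree ≤ d * e := by
  rw [Matrix.det_apply]
  refine natDegree_sum_le_of_forall_le _ _ fun σ _ => ?_
  refine (natDegree_smul_le _ _).trans ((natDegree_prod_le _ _).trans ?_)
  exact (Finset.sum_le_card_nsmul _ _ e fun i _ => h _ _).trans (by simp)

/-- Each product in the Leibniz formula has `d` factors of degree at most `e`, so its coefficient at
`d * e` is the product of the top coefficients. Applied to `arPoly`, whose top coefficient is `I`,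
this makes the determinant monic of degree `d * p`. -/
lemma coeff_det_mul {d e : ℕ} (M : Matrix (Fin d) (Fin d) ℂ[X])
    (h : ∀ i j, (M i j).natDegree ≤ e) :
    M.det.coeff (d * e) = (M.map fun P => P.coeff e).det := by
  rw [Matrix.det_apply, Matrix.det_apply, finsetSum_coeff]
  refine Finset.sum_congr rfl fun σ _ => ?_
  rw [coeff_smul]
  congr 1
  have := coeff_prod_of_natDegree_le (s := Finset.univ) (fun i => M (σ i) i) e fun i _ => h _ _
  simpa using this

lemma natDegree_det_arPoly_le (p : ℕ) {d : ℕ} (A : ℕ → Matrix (Fin d) (Fin d) ℝ) :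
    (arPoly p A).det.natDegree ≤ d * p :=
  natDegree_det_le_mul _ (natDegree_arPoly_le p A)

lemma coeff_det_arPoly (p : ℕ) {d : ℕ} (A : ℕ → Matrix (Fin d) (Fin d) ℝ) :
    (arPoly p A).det.coeff (d * p) = 1 := by
  rw [coeff_det_mul _ (natDegree_arPoly_le p A)]
  convert Matrix.det_one (n := Fin d) (R := ℂ)
  ext i j
  rw [Matrix.map_apply, coeff_arPoly, if_pos rfl]

lemma monic_det_arPoly (p : ℕ) {d : ℕ} (A : ℕ → Matrix (Fin d) (Fin d) ℝ) :
    (arPoly p A).det.Monic :=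
  monic_of_natDegree_le_of_coeff_eq_one _ (natDegree_det_arPoly_le p A) (coeff_det_arPoly p A)

lemma natDegree_det_arPoly (p : ℕ) {d : ℕ} (A : ℕ → Matrix (Fin d) (Fin d) ℝ) :
    (arPoly p A).det.natDegree = d * p :=
  natDegree_eq_of_le_of_coeff_ne_zero (natDegree_det_arPoly_le p A)
    (by rw [coeff_det_arPoly]; exact one_ne_zero)

/-! ## The spectra of a complete set of regular solvents -/

/-- In `det A = det Q * charpoly R_j` regularity keeps `det Q` nonzero on `σ(R_j)`, so every
eigenvalue of `R_j` has the same multiplicity in `det A` and in `charpoly R_j`. By completeness the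
roots of `det A` are contained, with multiplicity, in the union of those of the `charpoly R_j`. Both
multisets have `d * p` elements, hence agree, and a shared eigenvalue would be counted twice. -/
lemma disjoint_spectrum_of_isCompleteRegularSolvents {p d : ℕ}
    {A : ℕ → Matrix (Fin d) (Fin d) ℝ} {R : Fin p → Matrix (Fin d) (Fin d) ℂ}
    (hR : IsCompleteRegularSolvents p A R) {k l : Fin p} (hkl : k ≠ l) {a : ℂ}
    (hk : a ∈ spectrum ℂ (R k)) : a ∉ spectrum ℂ (R l) := by
  classical
  intro hl
  set D := (arPoly p A).det
  have hcount : ∀ j, ∀ b ∈ spectrum ℂ (R j), (R j).charpoly.roots.count b = D.roots.count b := by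
    intro j b hb
    obtain ⟨Q, hQ, hdis⟩ := (hR.1 j).2
    have hD : D = Q.det * (R j).charpoly := by
      rw [Matrix.charpoly, ← Matrix.det_mul, ← hQ]
    have hD0 : Q.det * (R j).charpoly ≠ 0 := hD ▸ (monic_det_arPoly p A).ne_zero
    rw [hD, count_roots, count_roots, rootMultiplicity_mul hD0,
      rootMultiplicity_eq_zero (p := Q.det), zero_add]
    exact fun h => Set.disjoint_left.1 hdis hb (mem_polySpectrum.2 h)
  have hmem : ∀ j b, b ∈ spectrum ℂ (R j) → 1 ≤ (R j).charpoly.roots.count b := fun j b hb =>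
    Multiset.one_le_count_iff_mem.2 <| (mem_roots (Matrix.charpoly_monic _).ne_zero).2
      (Matrix.mem_spectrum_iff_isRoot_charpoly.1 hb)
  have hle : D.roots ≤ ∑ j, (R j).charpoly.roots := by
    refine Multiset.le_iff_count.2 fun b => ?_
    by_cases hb : b ∈ D.roots
    · have : b ∈ ⋃ j, spectrum ℂ (R j) := by
        rw [← hR.2, mem_polySpectrum]
        exact isRoot_of_mem_roots hb
      obtain ⟨j, hj⟩ := Set.mem_iUnion.1 this
      rw [← hcount j b hj, Multiset.count_sum']
      exact Finset.single_le_sum (f := fun j => (R j).charpoly.roots.count b)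
        (fun _ _ => Nat.zero_le _) (Finset.mem_univ j)
    · rw [Multiset.count_eq_zero_of_notMem hb]
      exact Nat.zero_le _
  have hcard : (∑ j, (R j).charpoly.roots).card ≤ D.roots.card := by
    rw [Multiset.card_sum, ← (IsAlgClosed.splits D).natDegree_eq_card_roots, natDegree_det_arPoly]
    refine (Finset.sum_le_card_nsmul _ _ d fun j _ => ?_).trans (by simp [mul_comm])
    exact (card_roots' _).trans (by simp [Matrix.charpoly_natDegree_eq_dim])
  have heq := congrArg (Multiset.count a) (Multiset.eq_of_le_of_card_le hle hcard)
  rw [Multiset.count_sum'] at heq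
  have h2 : ∑ j ∈ {k, l}, (R j).charpoly.roots.count a ≤ ∑ j, (R j).charpoly.roots.count a :=
    Finset.sum_le_sum_of_subset (Finset.subset_univ _)
  rw [Finset.sum_pair hkl, hcount k a hk, ← heq, ← hcount l a hl] at h2
  have := hmem l a hl
  omega

/-! ## The expansion of `A(λ)⁻¹ B(λ)` at infinity -/

/-- The coefficients `β` solve the equation `A(λ) ∑ β_l λ^(-l) = B(λ)`. -/
lemma coeff_maPoly_eq_stateBeta {p q d m : ℕ} (hqp : q < p) (A : ℕ → Matrix (Fin d) (Fin d) ℝ)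
    (B : ℕ → Matrix (Fin d) (Fin m) ℝ) {l : ℕ} (hl : l < p) :
    (if p - 1 - l ≤ q then B (q - (p - 1 - l)) else 0) =
      stateBeta p q A B (l + 1) +
        ∑ j ∈ Finset.range l, A (l - j) * stateBeta p q A B (j + 1) := by
  by_cases h : l + 1 < p - q
  · rw [if_neg (by omega), stateBeta, if_pos h, Finset.sum_eq_zero, add_zero]
    intro j hj
    rw [Finset.mem_range] at hj
    rw [stateBeta, if_pos (by omega), Matrix.mul_zero]
  · rw [if_pos (by omega), stateBeta, if_neg h, Nat.add_sub_cancel,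
      Fin.sum_univ_eq_sum_range fun i => A (i + 1) * stateBeta p q A B (l + 1 - (i + 1)),
      ← Finset.sum_range_reflect,
      show q - (p - 1 - l) = l + 1 - (p - q) by omega, neg_add_eq_sub, sub_add, eq_comm,
      sub_eq_self, sub_eq_zero]
    refine Finset.sum_congr rfl fun j hj => ?_
    rw [Finset.mem_range] at hj
    congr 2 <;> omega

/-- The polynomial part `∑ β_{j+1} λ^(i-1-j)` of `λ^i A(λ)⁻¹ B(λ)`. -/
def polyPart (p q : ℕ) {d m : ℕ} (A : ℕ → Matrix (Fin d) (Fin d) ℝ)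
    (B : ℕ → Matrix (Fin d) (Fin m) ℝ) (i : ℕ) : Matrix (Fin d) (Fin m) ℂ[X] :=
  ∑ j ∈ Finset.range i,
    (X ^ (i - 1 - j) : ℂ[X]) • (toC (stateBeta p q A B (j + 1))).map Polynomial.C

/-- The numerator of `λ^i A(λ)⁻¹ B(λ)` without its polynomial part, as left fraction. -/
def numPart (p q : ℕ) {d m : ℕ} (A : ℕ → Matrix (Fin d) (Fin d) ℝ)
    (B : ℕ → Matrix (Fin d) (Fin m) ℝ) (i : ℕ) : Matrix (Fin d) (Fin m) ℂ[X] :=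
  (X ^ i : ℂ[X]) • maPoly q B - arPoly p A * polyPart p q A B i

lemma toC_mul {l m n : Type*} [Fintype m] (M : Matrix l m ℝ) (N : Matrix m n ℝ) :
    toC (M * N) = toC M * toC N :=
  Matrix.map_mul (f := Complex.ofRealHom)

lemma coeff_mul_map_C {l m n : Type*} [Fintype m] (P : Matrix l m ℂ[X]) (M : Matrix m n ℂ) (i : l)
    (j : n) (k : ℕ) :
    ((P * M.map C) i j).coeff k = ((P.map fun x => x.coeff k) * M) i j := by
  simp [Matrix.mul_apply, finsetSum_coeff]

/-- The recursion for `β` says that subtracting `A(λ)` times the polynomial part cancels all powers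
from `λ^p` upwards. At `λ^(p-1)` the recursion lacks only its term `β_{i+1}`, which remains. -/
lemma coeff_numPart {p q d m : ℕ} (hqp : q < p) (A : ℕ → Matrix (Fin d) (Fin d) ℝ)
    (B : ℕ → Matrix (Fin d) (Fin m) ℝ) {i k : ℕ} (hi : i < p) (hk : p ≤ k + 1)
    (r : Fin d) (c : Fin m) :
    (numPart p q A B i r c).coeff k =
      if k + 1 = p then toC (stateBeta p q A B (i + 1)) r c else 0 := by
  have hco : (numPart p q A B i r c).coeff k =
      (if k - i ≤ q then toC (B (q - (k - i))) else 0 : Matrix (Fin d) (Fin m) ℂ) r c -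
      ∑ j ∈ Finset.range i,
        ((if k - (i - 1 - j) = p then (1 : Matrix (Fin d) (Fin d) ℂ)
          else if k - (i - 1 - j) < p then toC (A (p - (k - (i - 1 - j)))) else 0) *
          toC (stateBeta p q A B (j + 1))) r c := by
    rw [numPart, polyPart, Matrix.sub_apply, coeff_sub, Matrix.smul_apply, smul_eq_mul,
      coeff_X_pow_mul', if_pos (by omega), coeff_maPoly, Matrix.mul_sum, Matrix.sum_apply,
      finsetSum_coeff]
    congr 1
    refine Finset.sum_congr rfl fun j hj => ?_
    rw [Matrix.mul_smul, Matrix.smul_apply, smul_eq_mul, coeff_X_pow_mul', if_pos (by omega),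
      coeff_mul_map_C]
    refine congrFun (congrFun (congrArg (· * toC (stateBeta p q A B (j + 1))) ?_) r) c
    ext a b
    rw [Matrix.map_apply, coeff_arPoly]
  rw [hco]
  by_cases hbig : i + p < k + 1
  · rw [if_neg (by omega), if_neg (by omega), Matrix.zero_apply, Finset.sum_eq_zero, sub_zero]
    intro j hj
    rw [Finset.mem_range] at hj
    rw [if_neg (by omega), if_neg (by omega), Matrix.zero_mul, Matrix.zero_apply]
  -- With this `l` the power `λ^k` of `λ^i B(λ)` carries the coefficient of `B(λ)` at `λ^(p-1-l)`,
  -- and the `j`-th summand carries that of `A(λ)` at `λ^(p-l+j)`: `A_{l-j}` for `j < l`, the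
  -- identity for `j = l`, zero beyond. The term `j = l` is present exactly when `k ≥ p`.
  obtain ⟨l, hl⟩ : ∃ l, l + (k + 1) = i + p := ⟨i + p - (k + 1), by omega⟩
  have hB := congrArg (fun M => toC M r c) (coeff_maPoly_eq_stateBeta hqp A B (l := l) (by omega))
  have hsum : ∀ j ∈ Finset.range l,
      ((if k - (i - 1 - j) = p then (1 : Matrix (Fin d) (Fin d) ℂ)
          else if k - (i - 1 - j) < p then toC (A (p - (k - (i - 1 - j)))) else 0) *
          toC (stateBeta p q A B (j + 1))) r c =
        toC (A (l - j) * stateBeta p q A B (j + 1)) r c := fun j hj => by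
    rw [Finset.mem_range] at hj
    rw [if_neg (by omega), if_pos (by omega), toC_mul,
      show p - (k - (i - 1 - j)) = l - j by omega]
  have hBe : (if k - i ≤ q then toC (B (q - (k - i))) else 0 : Matrix (Fin d) (Fin m) ℂ) r c =
      toC (stateBeta p q A B (l + 1)) r c +
        ∑ j ∈ Finset.range l, toC (A (l - j) * stateBeta p q A B (j + 1)) r c := by
    have h1 : toC (if p - 1 - l ≤ q then B (q - (p - 1 - l)) else 0) r c =
        (if k - i ≤ q then toC (B (q - (k - i))) else 0 : Matrix (Fin d) (Fin m) ℂ) r c := by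
      rw [show p - 1 - l = k - i by omega]
      split_ifs
      · rfl
      · simp [toC]
    rw [← h1]
    refine hB.trans ?_
    simp [toC, Matrix.sum_apply]
  rw [hBe]
  split_ifs with hkp
  · obtain rfl : l = i := by omega
    rw [Finset.sum_congr rfl hsum, add_sub_cancel_right]
  · rw [← Finset.sum_subset (Finset.range_subset_range.2 (show l + 1 ≤ i by omega)),
      Finset.sum_range_succ, Finset.sum_congr rfl hsum, if_pos (by omega), Matrix.one_mul, add_comm,
      sub_self]
    intro j hj hj'
    rw [Finset.mem_range] at hj hj'
    rw [if_neg (by omega), if_neg (by omega), Matrix.zero_mul, Matrix.zero_apply]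

lemma coeff_arPoly_mul {p d m e : ℕ} (A : ℕ → Matrix (Fin d) (Fin d) ℝ)
    (N : Matrix (Fin d) (Fin m) ℂ[X]) (hN : ∀ i j, (N i j).natDegree ≤ e) (i : Fin d) (j : Fin m) :
    ((arPoly p A * N) i j).coeff (p + e) = (N i j).coeff e := by
  rw [Matrix.mul_apply, finsetSum_coeff]
  simp_rw [coeff_mul_add_eq_of_natDegree_le (natDegree_arPoly_le p A _ _) (hN _ _), coeff_arPoly, if_pos]
  simp [Matrix.one_apply]

/-- The leading coefficient of `A(λ)` is `I`, so multiplication by it raises the degree by exactly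
`p`. The induction lowers a crude bound `e + f` one step at a time. -/
lemma natDegree_lt_of_arPoly_mul_natDegree_le {p d m e : ℕ} (A : ℕ → Matrix (Fin d) (Fin d) ℝ)
    (N : Matrix (Fin d) (Fin m) ℂ[X])
    (hN : ∀ i j, ((arPoly p A * N) i j).natDegree ≤ p + e) (i : Fin d) (j : Fin m) :
    (N i j).natDegree ≤ e := by
  obtain ⟨f, hf⟩ : ∃ f, ∀ i j, (N i j).natDegree ≤ e + f :=
    ⟨∑ i, ∑ j, (N i j).natDegree, fun i j =>
      ((Finset.single_le_sum (f := fun j => (N i j).natDegree) (fun _ _ => Nat.zero_le _)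
        (Finset.mem_univ j)).trans (Finset.single_le_sum
          (f := fun i => ∑ j, (N i j).natDegree) (fun _ _ => Nat.zero_le _)
          (Finset.mem_univ i))).trans (Nat.le_add_left _ _)⟩
  induction f with
  | zero => exact hf i j
  | succ f ih =>
    refine ih fun a b => ?_
    refine natDegree_le_iff_coeff_eq_zero.2 fun k hk => ?_
    rcases (show e + f + 1 ≤ k from hk).eq_or_lt with rfl | hlt
    · rw [show e + f + 1 = e + (f + 1) by omega, ← coeff_arPoly_mul (p := p) A N hf]
      exact coeff_eq_zero_of_natDegree_lt ((hN a b).trans_lt (by omega))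
    · exact coeff_eq_zero_of_natDegree_lt ((hf a b).trans_lt (by omega))

/-- The remainder of `λ^i adj(A) B` modulo `D = det A` is `N = adj(A) * numPart`. Its degree is
controlled without estimating the adjugate: `A N = D • numPart` has degree at most `deg D + p - 1`,
and dividing by the monic `A` leaves at most `deg D - 1`, with top coefficient `β_{i+1}`. -/
lemma coeff_modByMonic_det_arPoly {p q d m : ℕ} (hqp : q < p)
    (A : ℕ → Matrix (Fin d) (Fin d) ℝ) (B : ℕ → Matrix (Fin d) (Fin m) ℝ) {i n : ℕ} (hi : i < p)
    (hn : n + 1 = (arPoly p A).det.natDegree) (r : Fin d) (c : Fin m) :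
    ((X ^ i * ((arPoly p A).adjugate * maPoly q B) r c) %ₘ (arPoly p A).det).coeff n =
      toC (stateBeta p q A B (i + 1)) r c := by
  set D := (arPoly p A).det with hD
  have hDm : D.Monic := monic_det_arPoly p A
  set N := (arPoly p A).adjugate * numPart p q A B i with hN
  have hAN : arPoly p A * N = D • numPart p q A B i := by
    rw [hN, ← Matrix.mul_assoc, Matrix.mul_adjugate, Matrix.smul_mul, Matrix.one_mul]
  have hb : ∀ r c, (numPart p q A B i r c).natDegree ≤ p - 1 := fun r c =>
    natDegree_le_iff_coeff_eq_zero.2 fun k hk => by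
      rw [coeff_numPart hqp A B hi (by omega), if_neg (by omega)]
  have hNdeg : ∀ r c, (N r c).natDegree ≤ n := by
    refine natDegree_lt_of_arPoly_mul_natDegree_le (p := p) A N fun r c => ?_
    rw [hAN, Matrix.smul_apply, smul_eq_mul]
    have := hb r c
    exact natDegree_mul_le.trans (by omega)
  have hcoeff : (N r c).coeff n = toC (stateBeta p q A B (i + 1)) r c := by
    rw [← coeff_arPoly_mul (p := p) A N hNdeg, hAN, Matrix.smul_apply, smul_eq_mul,
      show p + n = D.natDegree + (p - 1) by omega, coeff_mul_add_eq_of_natDegree_le le_rfl (hb r c),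
      hDm.coeff_natDegree, one_mul, coeff_numPart hqp A B hi (by omega), if_pos (by omega)]
  have hsplit : N r c + D * polyPart p q A B i r c =
      X ^ i * ((arPoly p A).adjugate * maPoly q B) r c := by
    have h : N + D • polyPart p q A B i =
        (X ^ i : ℂ[X]) • ((arPoly p A).adjugate * maPoly q B) := by
      rw [hN, numPart, Matrix.mul_sub, ← Matrix.mul_assoc, Matrix.adjugate_mul, Matrix.smul_mul,
        Matrix.one_mul, Matrix.mul_smul, sub_add_cancel]
    exact congrFun (congrFun h r) c
  rw [(div_modByMonic_unique (polyPart p q A B i r c) (N r c) hDm ⟨hsplit, ?_⟩).2, hcoeff]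
  refine degree_lt_degree ?_
  have := hNdeg r c
  omega

/-! ## Residues at solvents -/

lemma notMem_of_isResidueContour {d : ℕ} {P : Matrix (Fin d) (Fin d) ℂ[X]}
    {R : Matrix (Fin d) (Fin d) ℂ} {Γ : SimpleClosedContour} (hΓ : IsResidueContour P R Γ) {a : ℂ}
    (ha : a ∈ polySpectrum P) : a ∉ Γ.γ '' Set.Icc 0 1 := by
  by_cases h : a ∈ spectrum ℂ R
  · exact (hΓ.1 h).1
  · exact (hΓ.2 ⟨ha, h⟩).1

lemma det_evalAt_ne_zero_of_isResidueContour {d : ℕ} {P : Matrix (Fin d) (Fin d) ℂ[X]}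
    {R : Matrix (Fin d) (Fin d) ℂ} {Γ : SimpleClosedContour} (hΓ : IsResidueContour P R Γ) {z : ℂ}
    (hz : z ∈ Γ.γ '' Set.Icc 0 1) : (evalAt P z).det ≠ 0 :=
  fun h => notMem_of_isResidueContour hΓ h hz

lemma continuousOn_ratFun {d m : ℕ} {P : Matrix (Fin d) (Fin d) ℂ[X]}
    (Q : Matrix (Fin d) (Fin m) ℂ[X]) {s : Set ℂ} (hs : ∀ z ∈ s, (evalAt P z).det ≠ 0)
    (i : Fin d) (j : Fin m) : ContinuousOn (fun z => ratFun P Q z i j) s := by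
  simp_rw [ratFun_apply]
  refine ContinuousOn.div (by fun_prop) (by fun_prop) fun z hz => ?_
  rw [← det_evalAt]
  exact hs z hz

lemma evalAt_charmatrix {d : ℕ} (R : Matrix (Fin d) (Fin d) ℂ) (z : ℂ) :
    evalAt R.charmatrix z = z • (1 : Matrix (Fin d) (Fin d) ℂ) - R := by
  ext i j
  simp only [evalAt, Matrix.map_apply, Matrix.charmatrix_apply, eval_sub, eval_C, Matrix.sub_apply,
    Matrix.smul_apply, smul_eq_mul]
  by_cases h : i = j
  · subst h
    simp
  · simp [h]

/-- This is `(z - R) P⁻¹ B = Q⁻¹ B`: multiplication by `z` acts on `P⁻¹ B` as left multiplication by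
`R`, up to a term without poles on `σ(R)` when the solvent is regular. -/
lemma mul_ratFun_apply {d m : ℕ} {P Q : Matrix (Fin d) (Fin d) ℂ[X]}
    {R : Matrix (Fin d) (Fin d) ℂ} (hP : P = Q * R.charmatrix) (B : Matrix (Fin d) (Fin m) ℂ[X])
    {z : ℂ} (hz : (evalAt P z).det ≠ 0) (i : Fin d) (j : Fin m) :
    z * ratFun P B z i j = (R * ratFun P B z) i j + ratFun Q B z i j := by
  have hPz : evalAt P z = evalAt Q z * (z • (1 : Matrix (Fin d) (Fin d) ℂ) - R) := by
    rw [hP, evalAt_mul, evalAt_charmatrix]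
  have hQz : (evalAt Q z).det ≠ 0 := fun h => hz (by rw [hPz, Matrix.det_mul, h, zero_mul])
  have h1 : evalAt P z * ratFun P B z = evalAt B z := by
    rw [ratFun, ← Matrix.mul_assoc, Matrix.mul_nonsing_inv _ (Ne.isUnit hz), Matrix.one_mul]
  have h2 : (z • (1 : Matrix (Fin d) (Fin d) ℂ) - R) * ratFun P B z = ratFun Q B z := by
    conv_rhs => rw [ratFun, ← h1, hPz, Matrix.mul_assoc, ← Matrix.mul_assoc,
      Matrix.nonsing_inv_mul _ (Ne.isUnit hQz), Matrix.one_mul]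
  rw [← h2, Matrix.sub_mul, Matrix.smul_mul, Matrix.one_mul, Matrix.sub_apply, Matrix.smul_apply,
    smul_eq_mul, add_sub_cancel]

lemma integral_pow_mul_ratFun_eq_zero {d m : ℕ} {Q : Matrix (Fin d) (Fin d) ℂ[X]}
    (hQ : Q.det.Monic) (B : Matrix (Fin d) (Fin m) ℂ[X]) {Γ : SimpleClosedContour}
    (hΓ : polySpectrum Q ⊆ Γ.exterior) (n : ℕ) (i : Fin d) (j : Fin m) :
    Γ.integral (fun z => z ^ n * ratFun Q B z i j) = 0 := by
  obtain ⟨r, hr, -⟩ := exists_residues (X ^ n * (Q.adjugate * B) i j) Q.det hQ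
  have hmem : ∀ a ∈ Q.det.roots, a ∈ Γ.exterior := fun a ha =>
    hΓ (mem_polySpectrum.2 (isRoot_of_mem_roots ha))
  have h := hr Γ fun a ha => (hmem a ha).1
  rw [Finset.sum_eq_zero fun a ha => by
    rw [(hmem a (Multiset.mem_toFinset.1 ha)).2, mul_zero]] at h
  rw [mul_eq_zero_iff_left (by simp [Real.pi_ne_zero])] at h
  rw [← h]
  refine Γ.integral_congr fun z _ => ?_
  rw [ratFun_apply, eval_mul, eval_pow, eval_X, mul_div_assoc]

/-- Each exchange of a factor `z` for a factor `R` costs an integral of `z^n Q⁻¹ B`. Its poles lie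
in `σ(Q(·))`, which regularity places in the exterior of `Γ`, so the integral is zero. -/
lemma pow_mul_residueAlong_apply {d m : ℕ} {P Q : Matrix (Fin d) (Fin d) ℂ[X]}
    {R : Matrix (Fin d) (Fin d) ℂ} (hP : P = Q * R.charmatrix) (hPm : P.det.Monic)
    (hdis : Disjoint (spectrum ℂ R) (polySpectrum Q)) (B : Matrix (Fin d) (Fin m) ℂ[X])
    {Γ : SimpleClosedContour} (hΓ : IsResidueContour P R Γ) (n : ℕ) (i : Fin d) (j : Fin m) :
    (R ^ n * residueAlong (ratFun P B) Γ) i j =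
      (2 * Real.pi * Complex.I)⁻¹ * Γ.integral (fun z => z ^ n * ratFun P B z i j) := by
  have hQ : Q.det.Monic := by
    rw [hP, Matrix.det_mul] at hPm
    exact (Matrix.charpoly_monic R).of_mul_monic_right hPm
  have hQΓ : polySpectrum Q ⊆ Γ.exterior := fun a ha => by
    refine hΓ.2 ⟨?_, fun h => Set.disjoint_left.1 hdis h ha⟩
    rw [mem_polySpectrum] at ha ⊢
    rw [hP, Matrix.det_mul]
    exact root_mul_right_of_isRoot _ ha
  have hne : ∀ z ∈ Γ.γ '' Set.Icc 0 1, (evalAt P z).det ≠ 0 := fun z hz =>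
    det_evalAt_ne_zero_of_isResidueContour hΓ hz
  have hneQ : ∀ z ∈ Γ.γ '' Set.Icc 0 1, (evalAt Q z).det ≠ 0 := fun z hz h =>
    (hQΓ h).1 hz
  have hcont : ∀ n i j, ContinuousOn (fun z => z ^ n * ratFun P B z i j) (Γ.γ '' Set.Icc 0 1) :=
    fun n i j => (by fun_prop : Continuous fun z : ℂ => z ^ n).continuousOn.mul
      (continuousOn_ratFun B hne i j)
  induction n generalizing i with
  | zero => simp [residueAlong]
  | succ n ih =>
    have hstep : ∀ z ∈ Γ.γ '' Set.Icc 0 1, z ^ (n + 1) * ratFun P B z i j =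
        (∑ l, R i l * (z ^ n * ratFun P B z l j)) + z ^ n * ratFun Q B z i j := fun z hz => by
      rw [pow_succ, mul_assoc, mul_ratFun_apply hP B (hne z hz), mul_add, Matrix.mul_apply,
        Finset.mul_sum]
      simp_rw [mul_left_comm]
    have hc1 : ∀ l ∈ Finset.univ, ContinuousOn (fun z => R i l * (z ^ n * ratFun P B z l j))
        (Γ.γ '' Set.Icc 0 1) := fun l _ => continuousOn_const.mul (hcont n l j)
    have hc2 : ContinuousOn (fun z => z ^ n * ratFun Q B z i j) (Γ.γ '' Set.Icc 0 1) :=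
      (by fun_prop : Continuous fun z : ℂ => z ^ n).continuousOn.mul
        (continuousOn_ratFun B hneQ i j)
    rw [Γ.integral_congr hstep, Γ.integral_add (continuousOn_finsetSum _ hc1) hc2,
      integral_pow_mul_ratFun_eq_zero hQ B hQΓ, add_zero, Γ.integral_sum _ hc1, pow_succ',
      Matrix.mul_assoc, Matrix.mul_apply, Finset.mul_sum]
    refine Finset.sum_congr rfl fun l _ => ?_
    rw [ih, Γ.integral_const_mul, mul_left_comm]

/-- The residues of `λ^i A(λ)⁻¹ B(λ)` at all solvents sum up to the coefficient `β_{i+1}` of the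
expansion at infinity. -/
lemma sum_pow_mul_residueAlong {p q d m : ℕ} (hqp : q < p) {A : ℕ → Matrix (Fin d) (Fin d) ℝ}
    (B : ℕ → Matrix (Fin d) (Fin m) ℝ) {R : Fin p → Matrix (Fin d) (Fin d) ℂ}
    (hR : IsCompleteRegularSolvents p A R) {Γ : Fin p → SimpleClosedContour}
    (hΓ : ∀ k, IsResidueContour (arPoly p A) (R k) (Γ k)) {i : ℕ} (hi : i < p) :
    ∑ k, R k ^ i * residueAlong (ratFun (arPoly p A) (maPoly q B)) (Γ k) =
      toC (stateBeta p q A B (i + 1)) := by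
  ext r c
  have hDm := monic_det_arPoly p A
  obtain ⟨ρ, hρ, hsum⟩ := exists_residues
    (X ^ i * ((arPoly p A).adjugate * maPoly q B) r c) (arPoly p A).det hDm
  -- The row index `r` forces `d > 0`, so the degree `d * p` is positive.
  obtain ⟨n, hn⟩ : ∃ n, n + 1 = (arPoly p A).det.natDegree := by
    rw [natDegree_det_arPoly]
    exact Nat.exists_eq_succ_of_ne_zero (mul_pos r.pos (hqp.pos)).ne' |>.imp fun _ h => h.symm
  rw [← coeff_modByMonic_det_arPoly hqp A B hi hn, ← hsum n hn, Matrix.sum_apply]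
  have hk : ∀ k, (R k ^ i * residueAlong (ratFun (arPoly p A) (maPoly q B)) (Γ k)) r c =
      ∑ a ∈ (arPoly p A).det.roots.toFinset, ρ a * (Γ k).windingNumber a := fun k => by
    obtain ⟨Q, hQ, hdis⟩ := (hR.1 k).2
    rw [pow_mul_residueAlong_apply hQ hDm hdis _ (hΓ k), ← hρ (Γ k) fun a ha =>
      notMem_of_isResidueContour (hΓ k) (mem_polySpectrum.2 (isRoot_of_mem_roots ha))]
    congr 1
    refine (Γ k).integral_congr fun z _ => ?_
    rw [ratFun_apply, eval_mul, eval_pow, eval_X, mul_div_assoc]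
  simp_rw [hk]
  rw [Finset.sum_comm]
  refine Finset.sum_congr rfl fun a ha => ?_
  have haP : a ∈ polySpectrum (arPoly p A) :=
    mem_polySpectrum.2 (isRoot_of_mem_roots (Multiset.mem_toFinset.1 ha))
  obtain ⟨k, hak⟩ := Set.mem_iUnion.1 (hR.2 ▸ haP)
  -- Each pole lies in exactly one `σ(R_k)`: winding number one for that contour, zero for all
  -- others.
  rw [Finset.sum_eq_single k, ((hΓ k).1 hak).2, mul_one]
  · intro l _ hlk
    rw [((hΓ l).2 ⟨haP, disjoint_spectrum_of_isCompleteRegularSolvents hR hlk.symm hak⟩).2,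
      mul_zero]
  · exact fun h => absurd (Finset.mem_univ k) h

/-! ## Càdlàg paths -/

namespace IsCadlag

lemma map {E F : Type*} [TopologicalSpace E] [TopologicalSpace F] {x : ℝ≥0 → E} (hx : IsCadlag x)
    {φ : ℝ≥0 → E → F} (hφ : Continuous (Function.uncurry φ)) : IsCadlag fun t => φ t (x t) := by
  intro t
  obtain ⟨hr, l, hl⟩ := hx t
  refine ⟨hφ.continuousAt.comp_continuousWithinAt (continuousWithinAt_id.prodMk hr), φ t l, ?_⟩
  have h : Tendsto (fun s => (s, x s)) (𝓝[<] t) (𝓝 (t, l)) :=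
    (tendsto_id.mono_left nhdsWithin_le_nhds).prodMk_nhds hl
  exact (hφ.tendsto (t, l)).comp h

lemma pi {ι : Type*} {E : ι → Type*} [∀ i, TopologicalSpace (E i)] {x : ℝ≥0 → ∀ i, E i}
    (hx : ∀ i, IsCadlag fun t => x t i) : IsCadlag x := by
  intro t
  refine ⟨continuousWithinAt_pi.2 fun i => (hx i t).1, ?_⟩
  choose l hl using fun i => (hx i t).2
  exact ⟨l, tendsto_pi_nhds.2 hl⟩

variable {E : Type*} [NormedAddCommGroup E] {x : ℝ≥0 → E}

lemma exists_bound (hx : IsCadlag x) (T : ℝ≥0) : ∃ C, ∀ s ≤ T, ‖x s‖ ≤ C := by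
  have h : ∃ C, ∀ s ∈ Set.Icc 0 T, ‖x s‖ ≤ C := by
    refine isCompact_Icc.induction_on (p := fun S => ∃ C, ∀ s ∈ S, ‖x s‖ ≤ C) ⟨0, by simp⟩
      (fun S S' hS ⟨C, hC⟩ => ⟨C, fun s hs => hC s (hS hs)⟩) ?_ fun t _ => ?_
    · rintro S S' ⟨C, hC⟩ ⟨C', hC'⟩
      refine ⟨max C C', fun s hs => ?_⟩
      rcases hs with hs | hs
      · exact (hC s hs).trans (le_max_left _ _)
      · exact (hC' s hs).trans (le_max_right _ _)
    · obtain ⟨hr, l, hl⟩ := hx t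
      rw [continuousWithinAt_Ioi_iff_Ici] at hr
      have h1 : ∀ᶠ s in 𝓝[≥] t, ‖x s‖ ≤ max (‖x t‖ + 1) (‖l‖ + 1) :=
        (hr.norm.eventually_lt_const (lt_add_one _)).mono
          fun s hs => hs.le.trans (le_max_left _ _)
      have h2 : ∀ᶠ s in 𝓝[<] t, ‖x s‖ ≤ max (‖x t‖ + 1) (‖l‖ + 1) :=
        (hl.norm.eventually_lt_const (lt_add_one _)).mono
          fun s hs => hs.le.trans (le_max_right _ _)
      refine ⟨{s | ‖x s‖ ≤ max (‖x t‖ + 1) (‖l‖ + 1)}, mem_nhdsWithin_of_mem_nhds ?_,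
        _, fun s hs => hs⟩
      rw [← nhdsLT_sup_nhdsGE]
      exact ⟨h2, h1⟩
  obtain ⟨C, hC⟩ := h
  exact ⟨C, fun s hs => hC s ⟨zero_le, hs⟩⟩

lemma measurable [MeasurableSpace E] [BorelSpace E] (hx : IsCadlag x) : Measurable x := by
  -- Approximation by the next grid point strictly to the right of `u`; the `+ 1` after the floor
  -- makes it strict, so right continuity gives convergence.
  refine measurable_of_tendsto_metrizable
    (f := fun (n : ℕ) u => x ((⌊((n : ℝ≥0) + 1) * u⌋₊ + 1 : ℝ≥0) / (n + 1))) (fun n => ?_) ?_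
  · have h1 : Measurable fun u : ℝ≥0 => ⌊((n : ℝ≥0) + 1) * u⌋₊ :=
      Nat.measurable_floor.comp (measurable_const.mul measurable_id)
    exact (measurable_from_nat (f := fun k : ℕ => x ((k + 1 : ℝ≥0) / (n + 1)))).comp h1
  · refine tendsto_pi_nhds.2 fun u => ?_
    refine (hx u).1.tendsto.comp (tendsto_nhdsWithin_iff.2 ⟨?_, Eventually.of_forall fun n => ?_⟩)
    · refine tendsto_of_tendsto_of_tendsto_of_le_of_le (g := fun _ => u)
        (h := fun n : ℕ => u + 1 / ((n : ℝ≥0) + 1)) tendsto_const_nhds ?_ (fun n => ?_) fun n => ?_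
      · simpa using (tendsto_const_nhds (x := u)).add
          (tendsto_one_div_add_atTop_nhds_zero_nat (𝕜 := ℝ≥0))
      · simp only
        rw [le_div_iff₀ (by positivity), mul_comm]
        exact (Nat.lt_floor_add_one _).le
      · simp only
        have h0 : (n : ℝ≥0) + 1 ≠ 0 := by positivity
        rw [div_le_iff₀ (by positivity), add_mul u, one_div_mul_cancel h0, mul_comm u]
        gcongr
        exact Nat.floor_le zero_le
    · rw [Set.mem_Ioi, lt_div_iff₀ (by positivity), mul_comm]
      exact Nat.lt_floor_add_one _

lemma continuousWithinAt_toNNReal (hx : IsCadlag x) (t : ℝ≥0) :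
    ContinuousWithinAt (fun s : ℝ => x s.toNNReal) (Set.Ioi (t : ℝ)) t := by
  have h : ContinuousWithinAt x (Set.Ioi t) (t : ℝ).toNNReal := by
    rw [Real.toNNReal_coe]
    exact (hx t).1
  exact h.comp continuous_real_toNNReal.continuousWithinAt fun s hs =>
    (Real.lt_toNNReal_iff_coe_lt).2 hs

variable [SecondCountableTopology E]

lemma intervalIntegrable (hx : IsCadlag x) (T : ℝ≥0) :
    IntervalIntegrable (fun s : ℝ => x s.toNNReal) volume 0 T := by
  borelize E
  obtain ⟨C, hC⟩ := hx.exists_bound T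
  rw [intervalIntegrable_iff]
  refine Measure.integrableOn_of_bounded (M := C) (by simp)
    (hx.measurable.comp measurable_real_toNNReal).aestronglyMeasurable ?_
  refine (ae_restrict_iff' measurableSet_uIoc).2 (Eventually.of_forall fun s hs => hC _ ?_)
  rw [Set.uIoc_of_le (NNReal.coe_nonneg T)] at hs
  exact Real.toNNReal_le_iff_le_coe.2 hs.2

variable [NormedSpace ℝ E]

lemma hasDerivWithinAt_integral [CompleteSpace E] (hx : IsCadlag x) (t : ℝ≥0) :
    HasDerivWithinAt (fun r : ℝ => ∫ s in (0 : ℝ)..r, x s.toNNReal) (x t) (Set.Ioi (t : ℝ)) t := by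
  borelize E
  have h := intervalIntegral.integral_hasDerivWithinAt_right (hx.intervalIntegrable t)
    (s := Set.Ici (t : ℝ)) (t := Set.Ioi (t : ℝ))
    (hx.measurable.comp measurable_real_toNNReal).stronglyMeasurable.stronglyMeasurableAtFilter
    (hx.continuousWithinAt_toNNReal t)
  rw [Real.toNNReal_coe] at h
  exact h.mono Set.Ioi_subset_Ici_self

lemma continuousOn_integral (hx : IsCadlag x) (T : ℝ≥0) :
    ContinuousOn (fun r : ℝ => ∫ s in (0 : ℝ)..r, x s.toNNReal) (Set.Icc 0 T) := by
  have h := intervalIntegral.continuousOn_primitive_interval' (hx.intervalIntegrable T)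
    (a := 0) Set.left_mem_uIcc
  rwa [Set.uIcc_of_le (NNReal.coe_nonneg T)] at h

/-- Two càdlàg modifications are indistinguishable. -/
lemma eq_of_dense {F : Type*} [TopologicalSpace F] [T2Space F] {x y : ℝ≥0 → F} (hx : IsCadlag x)
    (hy : IsCadlag y) {s : Set ℝ≥0} (hs : Dense s) (h : ∀ t ∈ s, x t = y t) : x = y := by
  funext t
  have : (𝓝[Set.Ioi t ∩ s] t).NeBot := by
    rw [← mem_closure_iff_nhdsWithin_neBot]
    refine closure_minimal (hs.open_subset_closure_inter isOpen_Ioi) isClosed_closure ?_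
    rw [closure_Ioi]
    exact Set.self_mem_Ici
  have hle : 𝓝[Set.Ioi t ∩ s] t ≤ 𝓝[Set.Ioi t] t := nhdsWithin_mono _ Set.inter_subset_left
  refine tendsto_nhds_unique_of_eventuallyEq ((hx t).1.mono_left hle) ((hy t).1.mono_left hle) ?_
  exact eventually_mem_nhdsWithin.mono fun u hu => h u hu.2

end IsCadlag

/-! ## Riemann sums with càdlàg integrators -/

namespace TimePartition

variable {t : ℝ≥0} (π : TimePartition t)

lemma sub_le_mesh {i : ℕ} (hi : i < π.N) : π.pts (i + 1) - π.pts i ≤ π.mesh :=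
  Finset.le_sup (f := fun i => π.pts (i + 1) - π.pts i) (Finset.mem_range.2 hi)

/-- The first point of the partition that is at least `u`. -/
def next (u : ℝ≥0) : ℝ≥0 := π.pts (sInf {i | u ≤ π.pts i})

lemma next_eq {u : ℝ≥0} {i : ℕ} (h : π.pts i < u) (h' : u ≤ π.pts (i + 1)) :
    π.next u = π.pts (i + 1) := by
  have hs : sInf {i | u ≤ π.pts i} = i + 1 := by
    refine le_antisymm (Nat.sInf_le h') (le_csInf ⟨_, h'⟩ fun j hj => ?_)
    by_contra! hlt
    exact absurd (hj.trans (π.mono (Nat.lt_succ_iff.1 hlt))) h.not_ge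
  rw [next, hs]

lemma exists_lt_le {u : ℝ≥0} (h0 : 0 < u) (hu : u ≤ t) :
    ∃ i < π.N, π.pts i < u ∧ u ≤ π.pts (i + 1) := by
  classical
  have hex : ∃ i, u ≤ π.pts i := ⟨π.N, by rwa [π.last]⟩
  have hN : Nat.find hex ≤ π.N := Nat.find_min' hex (by rwa [π.last])
  have hpos : Nat.find hex ≠ 0 := fun h => by
    have := Nat.find_spec hex
    rw [h, π.first] at this
    exact this.not_gt h0
  obtain ⟨i, hi⟩ := Nat.exists_eq_succ_of_ne_zero hpos
  refine ⟨i, by omega, not_le.1 (Nat.find_min hex (by omega)), ?_⟩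
  rw [← Nat.succ_eq_add_one, ← hi]
  exact Nat.find_spec hex

lemma le_next {u : ℝ≥0} (h0 : 0 < u) (hu : u ≤ t) : u ≤ π.next u := by
  obtain ⟨i, -, h, h'⟩ := π.exists_lt_le h0 hu
  rwa [π.next_eq h h']

lemma next_le {u : ℝ≥0} (h0 : 0 < u) (hu : u ≤ t) : π.next u ≤ t := by
  obtain ⟨i, hi, h, h'⟩ := π.exists_lt_le h0 hu
  rw [π.next_eq h h']
  exact (π.mono hi).trans_eq π.last

lemma next_le_add_mesh {u : ℝ≥0} (h0 : 0 < u) (hu : u ≤ t) : π.next u ≤ u + π.mesh := by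
  obtain ⟨i, hi, h, h'⟩ := π.exists_lt_le h0 hu
  rw [π.next_eq h h']
  calc π.pts (i + 1) ≤ π.pts i + (π.pts (i + 1) - π.pts i) := le_add_tsub
    _ ≤ u + π.mesh := add_le_add h.le (π.sub_le_mesh hi)

lemma exists_mesh_tendsto_zero (t : ℝ≥0) :
    ∃ π : ℕ → TimePartition t, Tendsto (fun n => (π n).mesh) atTop (𝓝 0) := by
  refine ⟨fun n => ⟨n + 1, fun i => min (i * (t / (n + 1))) t, ?_, by simp, ?_⟩, ?_⟩
  · intro i j hij
    simp only
    gcongr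
  · simp only [Nat.cast_add, Nat.cast_one]
    rw [mul_div_cancel₀ _ (by positivity), min_self]
  · refine tendsto_of_tendsto_of_tendsto_of_le_of_le (g := fun _ => 0)
      (h := fun n : ℕ => t * (1 / ((n : ℝ≥0) + 1))) tendsto_const_nhds ?_ (fun n => zero_le)
      fun n => Finset.sup_le fun i _ => ?_
    · simpa using (tendsto_one_div_add_atTop_nhds_zero_nat (𝕜 := ℝ≥0)).const_mul t
    · simp only [Nat.cast_add, Nat.cast_one, mul_one_div]
      rw [tsub_le_iff_left, ← min_add_add_right, add_mul, one_mul]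
      exact min_le_min le_rfl le_self_add

end TimePartition

/-- Summation by parts for Riemann sums. -/
lemma sum_mul_sub_eq {f f' : ℝ → ℂ} (hf : ∀ u, HasDerivAt f (f' u) u) (hf' : Continuous f')
    (x : ℝ≥0 → ℂ) {t : ℝ≥0} (π : TimePartition t) :
    IntervalIntegrable (fun u : ℝ => f' u * x (π.next u.toNNReal)) volume 0 t ∧
    ∑ i ∈ Finset.range π.N, f (π.pts i) * (x (π.pts (i + 1)) - x (π.pts i)) =
      f t * x t - f 0 * x 0 - ∫ u in (0 : ℝ)..t, f' u * x (π.next u.toNNReal) := by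
  set g : ℝ → ℂ := fun u => f' u * x (π.next u.toNNReal)
  have hle : ∀ i, (π.pts i : ℝ) ≤ π.pts (i + 1) := fun i => π.mono i.le_succ
  have hcongr : ∀ i, ∀ u ∈ Set.uIoc (π.pts i : ℝ) (π.pts (i + 1)),
      f' u * x (π.pts (i + 1)) = g u := fun i u hu => by
    rw [Set.uIoc_of_le (hle i)] at hu
    simp only [g]
    rw [π.next_eq (Real.lt_toNNReal_iff_coe_lt.2 hu.1) (Real.toNNReal_le_iff_le_coe.2 hu.2)]
  have hint : ∀ i, IntervalIntegrable g volume (π.pts i) (π.pts (i + 1)) := fun i =>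
    ((hf'.mul continuous_const).intervalIntegrable _ _).congr (hcongr i)
  have hval : ∀ i, ∫ u in (π.pts i : ℝ)..π.pts (i + 1), g u =
      (f (π.pts (i + 1)) - f (π.pts i)) * x (π.pts (i + 1)) := fun i => by
    rw [← intervalIntegral.integral_congr_ae (Eventually.of_forall (hcongr i)),
      intervalIntegral.integral_mul_const,
      intervalIntegral.integral_eq_sub_of_hasDerivAt (fun u _ => hf u)
        (hf'.intervalIntegrable _ _)]
  have hsum := intervalIntegral.sum_integral_adjacent_intervals (f := g) (μ := volume)
    (a := fun i => (π.pts i : ℝ)) (n := π.N) fun i _ => hint i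
  have hall := IntervalIntegrable.trans_iterate (f := g) (μ := volume)
    (a := fun i => (π.pts i : ℝ)) (n := π.N) fun i _ => hint i
  rw [π.first, π.last, NNReal.coe_zero] at hsum hall
  refine ⟨hall, ?_⟩
  have htel := Finset.sum_range_sub (fun i => f (π.pts i) * x (π.pts i)) π.N
  rw [π.first, π.last, NNReal.coe_zero] at htel
  rw [← htel, ← hsum, ← Finset.sum_sub_distrib]
  refine Finset.sum_congr rfl fun i _ => ?_
  -- On each subinterval `x (next u)` is the constant `x(t_{i+1})`, so the integral of `f'` is an
  -- increment of `f` and the identity is Abel summation term by term.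
  rw [hval]
  ring

/-- Pathwise convergence of the Riemann sums. -/
lemma tendsto_sum_mul_sub {f f' : ℝ → ℂ} (hf : ∀ u, HasDerivAt f (f' u) u) (hf' : Continuous f')
    {x : ℝ≥0 → ℂ} (hx : IsCadlag x) {t : ℝ≥0} {π : ℕ → TimePartition t}
    (hπ : Tendsto (fun n => (π n).mesh) atTop (𝓝 0)) :
    Tendsto (fun n => ∑ i ∈ Finset.range (π n).N,
        f ((π n).pts i) * (x ((π n).pts (i + 1)) - x ((π n).pts i))) atTop
      (𝓝 (f t * x t - f 0 * x 0 - ∫ u in (0 : ℝ)..t, f' u * x u.toNNReal)) := by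
  simp_rw [fun n => (sum_mul_sub_eq hf hf' x (π n)).2]
  refine tendsto_const_nhds.sub ?_
  obtain ⟨C, hC⟩ := hx.exists_bound t
  have hpos : ∀ u ∈ Set.uIoc (0 : ℝ) t, 0 < u.toNNReal ∧ u.toNNReal ≤ t := fun u hu => by
    rw [Set.uIoc_of_le (NNReal.coe_nonneg t)] at hu
    exact ⟨Real.toNNReal_pos.2 hu.1, Real.toNNReal_le_iff_le_coe.2 hu.2⟩
  refine intervalIntegral.tendsto_integral_filter_of_dominated_convergence
    (fun u => ‖f' u‖ * C) (Eventually.of_forall fun n => ?_)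
    (Eventually.of_forall fun n => Eventually.of_forall fun u hu => ?_)
    ((hf'.norm.mul continuous_const).intervalIntegrable _ _)
    (Eventually.of_forall fun u hu => ?_)
  · exact (sum_mul_sub_eq hf hf' x (π n)).1.def'.aestronglyMeasurable
  · rw [norm_mul]
    exact mul_le_mul_of_nonneg_left
      (hC _ ((π n).next_le (hpos u hu).1 (hpos u hu).2)) (norm_nonneg _)
  · refine tendsto_const_nhds.mul ?_
    -- The next partition point tends to `u` from the right, so right continuity of `x` is what
    -- gives pointwise convergence.
    have hr : ContinuousWithinAt x (Set.Ici u.toNNReal) u.toNNReal :=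
      continuousWithinAt_Ioi_iff_Ici.1 (hx _).1
    refine hr.tendsto.comp (tendsto_nhdsWithin_iff.2
      ⟨?_, Eventually.of_forall fun n => (π n).le_next (hpos u hu).1 (hpos u hu).2⟩)
    refine tendsto_of_tendsto_of_tendsto_of_le_of_le tendsto_const_nhds
      (h := fun n => u.toNNReal + (π n).mesh) ?_
      (fun n => (π n).le_next (hpos u hu).1 (hpos u hu).2)
      fun n => (π n).next_le_add_mesh (hpos u hu).1 (hpos u hu).2
    simpa using (tendsto_const_nhds (x := u.toNNReal)).add hπ

variable {Ω : Type*} [MeasurableSpace Ω]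

/-- The stochastic integral of a `C¹` function, by partial integration. -/
lemma stochIntegral_ae_eq {d m : ℕ} {μ : Measure Ω} [IsProbabilityMeasure μ]
    {L : ℝ≥0 → Ω → (Fin m → ℝ)} (hL : IsCadlagProcess μ L)
    {f f' : ℝ → Matrix (Fin d) (Fin m) ℂ}
    (hf : ∀ u i j, HasDerivAt (fun u => f u i j) (f' u i j) u) (hf' : Continuous f') (t : ℝ≥0) :
    stochIntegral μ (fun u => f u) L t =ᵐ[μ] fun ω i =>
      ∑ j, (f t i j * (L t ω j : ℂ) - f 0 i j * (L 0 ω j : ℂ) -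
        ∫ u in (0 : ℝ)..t, f' u i j * (L u.toNNReal ω j : ℂ)) := by
  set I : Ω → (Fin d → ℂ) := fun ω i =>
      ∑ j, (f t i j * (L t ω j : ℂ) - f 0 i j * (L 0 ω j : ℂ) -
        ∫ u in (0 : ℝ)..t, f' u i j * (L u.toNNReal ω j : ℂ))
  have hI : IsStochIntegral μ (fun u => f u) L t I := by
    intro π hπ
    refine tendstoInMeasure_of_tendsto_ae (fun n => Measurable.aestronglyMeasurable ?_) ?_
    · refine measurable_pi_lambda _ fun i => ?_
      simp only [stochSum, Finset.sum_apply, Matrix.mulVec, dotProduct]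
      refine Finset.measurable_fun_sum _ fun k _ => Finset.measurable_fun_sum _ fun j _ => ?_
      have h1 := (measurable_pi_apply j).comp (hL.1 ((π n).pts (k + 1)))
      have h2 := (measurable_pi_apply j).comp (hL.1 ((π n).pts k))
      exact measurable_const.mul (Complex.measurable_ofReal.comp (h1.sub h2))
    · filter_upwards [hL.2] with ω hω
      refine tendsto_pi_nhds.2 fun i => ?_
      have hsum : ∀ n, stochSum (fun u => f u) L (π n) ω i = ∑ j, ∑ k ∈ Finset.range (π n).N,
          f ((π n).pts k) i j *
            ((L ((π n).pts (k + 1)) ω j : ℂ) - (L ((π n).pts k) ω j : ℂ)) := fun n => by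
        simp only [stochSum, Finset.sum_apply, Matrix.mulVec, dotProduct]
        rw [Finset.sum_comm]
        simp
      simp_rw [hsum]
      refine tendsto_finsetSum _ fun j _ => ?_
      exact tendsto_sum_mul_sub (hf · i j) (by fun_prop)
        (hω.map (φ := fun _ y => ((y j : ℝ) : ℂ)) (by fun_prop)) hπ
  have hex : ∃ I, IsStochIntegral μ (fun u => f u) L t I := ⟨I, hI⟩
  rw [stochIntegral, dif_pos hex]
  -- The chosen integral and `I` are limits in probability along one common sequence of partitions,
  -- hence agree almost surely.
  obtain ⟨π, hπ⟩ := TimePartition.exists_mesh_tendsto_zero t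
  exact tendstoInMeasure_ae_unique (hex.choose_spec π hπ) (hI π hπ)

/-! ## Ornstein-Uhlenbeck processes -/

/-- The matrix exponential `e^(Rt)`. -/
abbrev expMat {d : ℕ} (R : Matrix (Fin d) (Fin d) ℂ) (t : ℝ) : Matrix (Fin d) (Fin d) ℂ :=
  NormedSpace.exp ((t : ℂ) • R)

section Exponential

variable {d : ℕ} (R : Matrix (Fin d) (Fin d) ℂ)

open scoped Matrix.Norms.Operator in
lemma hasDerivAt_expMat_apply (t : ℝ) (i j : Fin d) :
    HasDerivAt (fun t => expMat R t i j) ((R * expMat R t) i j) t := by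
  have h := hasDerivAt_exp_smul_const' (𝕂 := ℂ) R (t : ℂ)
  have h2 := ((Matrix.entryLinearMap ℂ ℂ i j).toContinuousLinearMap.hasFDerivAt).comp_hasDerivAt
    (t : ℂ) h
  exact h2.comp_ofReal

lemma continuous_expMat : Continuous (expMat R) :=
  continuous_matrix fun i j => continuous_iff_continuousAt.2 fun t =>
    (hasDerivAt_expMat_apply R t i j).continuousAt

lemma expMat_zero : expMat R 0 = 1 := by
  simp [expMat]

lemma expMat_add (s t : ℝ) : expMat R (s + t) = expMat R s * expMat R t := by
  rw [expMat, Complex.ofReal_add, add_smul,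
    Matrix.exp_add_of_commute _ _ (((Commute.refl R).smul_left _).smul_right _)]

lemma commute_expMat (t : ℝ) : R * expMat R t = expMat R t * R :=
  (((Commute.refl R).smul_right _).exp_right).eq

end Exponential

section OrnsteinUhlenbeck

variable {d m : ℕ}

/-- A vector of reals as a vector of complex numbers. -/
abbrev vecC {ι : Type*} (v : ι → ℝ) : ι → ℂ := fun i => (v i : ℂ)

/-- The variation of constants formula with càdlàg integrator solves the linear equation. -/
lemma eq_add_integral_of_variation_of_constants (R : Matrix (Fin d) (Fin d) ℂ)
    (G : Matrix (Fin d) (Fin m) ℂ) {x : ℝ≥0 → (Fin m → ℝ)} (hx : IsCadlag x)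
    {y : ℝ≥0 → (Fin d → ℂ)} (hyc : IsCadlag y)
    {S : Set ℝ≥0} (hS : Dense S)
    (hy : ∀ t ∈ S, y t = (expMat R t).mulVec (y 0) + fun i =>
      ∑ j, ((expMat R (t - t) * G) i j * (x t j : ℂ) - (expMat R (t - 0) * G) i j * (x 0 j : ℂ) -
        ∫ u in (0 : ℝ)..t, (-(R * expMat R (t - u) * G)) i j * (x u.toNNReal j : ℂ)))
    (t : ℝ≥0) :
    y t = y 0 + (∫ s in (0 : ℝ)..t, R.mulVec (y s.toNNReal)) +
      G.mulVec (vecC (x t) - vecC (x 0)) := by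
  set F : ℝ≥0 → (Fin d → ℂ) := fun u => (expMat R (-u)).mulVec (G.mulVec (vecC (x u))) with hF
  have hFc : IsCadlag F := by
    refine hx.map (φ := fun u y => (expMat R (-u)).mulVec (G.mulVec (vecC y))) ?_
    have h1 : Continuous fun z : ℝ≥0 × (Fin m → ℝ) => expMat R (-(z.1 : ℝ)) :=
      (continuous_expMat R).comp (by fun_prop)
    have h2 : Continuous fun z : ℝ≥0 × (Fin m → ℝ) => G.mulVec (vecC z.2) :=
      continuous_const.matrix_mulVec (by fun_prop)
    exact h1.matrix_mulVec h2
  -- After partial integration the jumps of `y` sit only in `G x(t)`: `y = h + G x` with `h(r) =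
  -- e^(Rr) w(r)` continuous.
  set w : ℝ → (Fin d → ℂ) := fun r =>
    y 0 - G.mulVec (vecC (x 0)) + R.mulVec (∫ u in (0 : ℝ)..r, F u.toNNReal) with hw
  set h : ℝ → (Fin d → ℂ) := fun r => (expMat R r).mulVec (w r) with hh
  have hyhS : ∀ t ∈ S, y t = h t + G.mulVec (vecC (x t)) := by
    intro t ht
    have hM : ∫ u in (0 : ℝ)..t, (R * expMat R t).mulVec (F u.toNNReal) =
        (R * expMat R t).mulVec (∫ u in (0 : ℝ)..t, F u.toNNReal) :=
      ((R * expMat R t).mulVecLin.toContinuousLinearMap).intervalIntegral_comp_comm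
        (hFc.intervalIntegrable t)
    have hMint : IntervalIntegrable (fun u : ℝ => (R * expMat R t).mulVec (F u.toNNReal))
        volume 0 t :=
      (hFc.map (φ := fun _ v => (R * expMat R t).mulVec v)
        (continuous_const.matrix_mulVec continuous_snd)).intervalIntegrable t
    have hint : ∀ i, ∑ j, ∫ u in (0 : ℝ)..t,
        (-(R * expMat R (t - u) * G)) i j * (x u.toNNReal j : ℂ) =
        -((R * expMat R t).mulVec (∫ u in (0 : ℝ)..t, F u.toNNReal)) i := fun i => by
      have hcg : ∀ u ∈ Set.uIcc (0 : ℝ) t,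
          ∑ j, (-(R * expMat R (t - u) * G)) i j * (x u.toNNReal j : ℂ) =
          -((R * expMat R t).mulVec (F u.toNNReal)) i := fun u hu => by
        rw [Set.uIcc_of_le (NNReal.coe_nonneg t)] at hu
        have hE : R * expMat R t * expMat R (-u) = R * expMat R (t - u) := by
          rw [Matrix.mul_assoc, ← expMat_add, ← sub_eq_add_neg]
        simp only [hF]
        rw [Real.coe_toNNReal _ hu.1, Matrix.mulVec_mulVec, Matrix.mulVec_mulVec, hE]
        exact congrFun (Matrix.neg_mulVec (vecC (x u.toNNReal)) (R * expMat R (t - u) * G)) i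
      rw [← intervalIntegral.integral_finsetSum, intervalIntegral.integral_congr hcg,
        intervalIntegral.integral_neg, ← hM]
      · exact congrArg Neg.neg
          ((ContinuousLinearMap.proj (R := ℂ) (φ := fun _ : Fin d => ℂ) i).intervalIntegral_comp_comm
            hMint)
      · intro j _
        have hc : IsCadlag fun u : ℝ≥0 => (-(R * expMat R (t - u) * G)) i j * (x u j : ℂ) := by
          refine hx.map (φ := fun u y => (-(R * expMat R (t - u) * G)) i j * ((y j : ℝ) : ℂ)) ?_
          have h1 : Continuous fun z : ℝ≥0 × (Fin m → ℝ) => expMat R (t - (z.1 : ℝ)) :=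
            (continuous_expMat R).comp (by fun_prop)
          have h2 : Continuous fun z : ℝ≥0 × (Fin m → ℝ) =>
              (-(R * expMat R (t - (z.1 : ℝ)) * G)) :=
            ((continuous_const.matrix_mul h1).matrix_mul continuous_const).neg
          exact (h2.matrix_elem i j).mul (by fun_prop)
        refine (hc.intervalIntegrable t).congr fun u hu => ?_
        rw [Set.uIoc_of_le (NNReal.coe_nonneg t)] at hu
        rw [Real.coe_toNNReal _ hu.1.le]
    rw [hy t ht]
    ext i
    simp only [Pi.add_apply, Finset.sum_sub_distrib, hint, hh, hw, Matrix.mulVec_add,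
      Matrix.mulVec_sub, Matrix.mulVec_mulVec, Pi.sub_apply, sub_self, sub_zero, expMat_zero,
      Matrix.one_mul, ← commute_expMat R]
    simp only [Matrix.mulVec, dotProduct]
    ring
  have hwc : ∀ t : ℝ≥0, ContinuousOn w (Set.Icc 0 (t : ℝ)) := fun t =>
    continuousOn_const.add
      (R.mulVecLin.toContinuousLinearMap.continuous.comp_continuousOn (hFc.continuousOn_integral t))
  have hhc : ∀ t : ℝ≥0, ContinuousOn h (Set.Icc 0 (t : ℝ)) := fun t => by
    refine continuousOn_pi.2 fun i => ?_
    change ContinuousOn (fun r => ∑ k, expMat R r i k * w r k) _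
    refine continuousOn_finsetSum _ fun k _ => ?_
    exact ((continuous_expMat R).matrix_elem i k).continuousOn.mul (continuousOn_pi.1 (hwc t) k)
  have hhcont : Continuous fun r : ℝ≥0 => h r := continuous_iff_continuousAt.2 fun t => by
    have hc : ContinuousOn (fun r : ℝ≥0 => h r) (Set.Iic (t + 1)) :=
      (hhc (t + 1)).comp (by fun_prop) fun r hr => ⟨r.2, hr⟩
    exact hc.continuousAt (Iic_mem_nhds (lt_add_one t))
  have hyh : ∀ t : ℝ≥0, y t = h t + G.mulVec (vecC (x t)) := by
    refine congrFun (hyc.eq_of_dense (hx.map (φ := fun r v => h r + G.mulVec (vecC v)) ?_) hS hyhS)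
    exact (hhcont.comp continuous_fst).add (continuous_const.matrix_mulVec (by fun_prop))
  -- The product rule gives `h' = R h + e^(Rr) R F(r) = R (h + G x) = R y`. Only the right
  -- derivative exists in general, since `F` is merely right continuous; the fundamental theorem
  -- needs no more.
  have hderiv : ∀ r ∈ Set.Ioo (0 : ℝ) t,
      HasDerivWithinAt h (R.mulVec (y r.toNNReal)) (Set.Ioi r) r := by
    intro r hr
    lift r to ℝ≥0 using hr.1.le
    rw [Real.toNNReal_coe]
    have hint := hFc.hasDerivWithinAt_integral r
    have hwd : HasDerivWithinAt w (R.mulVec (F r)) (Set.Ioi (r : ℝ)) r :=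
      ((R.mulVecLin.toContinuousLinearMap.restrictScalars ℝ).hasFDerivAt.comp_hasDerivWithinAt
        (r : ℝ) hint).const_add _
    rw [hasDerivWithinAt_pi] at hwd ⊢
    intro i
    have hs := HasDerivWithinAt.fun_sum (u := Finset.univ) fun (k : Fin d) _ =>
      (hasDerivAt_expMat_apply R r i k).hasDerivWithinAt.mul (hwd k)
    refine hs.congr_deriv ?_
    rw [Finset.sum_add_distrib]
    have e2 : (expMat R r).mulVec (R.mulVec (F r)) = R.mulVec (G.mulVec (vecC (x r))) := by
      simp only [hF]
      rw [Matrix.mulVec_mulVec, ← commute_expMat, Matrix.mulVec_mulVec, Matrix.mul_assoc,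
        ← expMat_add, add_neg_cancel, expMat_zero, Matrix.mul_one]
    rw [hyh r, Matrix.mulVec_add, ← e2, hh, Pi.add_apply]
    simp only [Matrix.mulVec_mulVec _ R]
    rfl
  have hRy : IsCadlag fun s => R.mulVec (y s) :=
    hyc.map (φ := fun _ v => R.mulVec v) (continuous_const.matrix_mulVec continuous_snd)
  rw [intervalIntegral.integral_eq_sub_of_hasDeriv_right_of_le (NNReal.coe_nonneg t) (hhc t) hderiv
    (hRy.intervalIntegrable t), hyh t]
  have h0 : h 0 = y 0 - G.mulVec (vecC (x 0)) := by
    simp [hh, hw, expMat_zero]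
  rw [h0, Matrix.mulVec_sub]
  abel

/-- An Ornstein-Uhlenbeck process solves the Langevin equation pathwise. -/
lemma IsOrnsteinUhlenbeck.ae_eq_add_integral {μ : Measure Ω} [IsProbabilityMeasure μ]
    {R : Matrix (Fin d) (Fin d) ℂ} {G : Matrix (Fin d) (Fin m) ℂ} {L : ℝ≥0 → Ω → (Fin m → ℝ)}
    (hL : IsCadlagProcess μ L) {Z : ℝ≥0 → Ω → (Fin d → ℂ)} (hZ : IsOrnsteinUhlenbeck μ R G L Z) :
    ∀ᵐ ω ∂μ, ∀ t : ℝ≥0, Z t ω = Z 0 ω + (∫ s in (0 : ℝ)..t, R.mulVec (Z s.toNNReal ω)) +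
      G.mulVec (vecC (L t ω) - vecC (L 0 ω)) := by
  -- The defining formula holds off a null set depending on `t`. A countable dense set of times
  -- gives one null set, and right continuity recovers the remaining times.
  have hall : ∀ᵐ ω ∂μ, ∀ n, Z (TopologicalSpace.denseSeq ℝ≥0 n) ω =
      (expMat R (TopologicalSpace.denseSeq ℝ≥0 n)).mulVec (Z 0 ω) +
        stochIntegral μ (fun u => expMat R (TopologicalSpace.denseSeq ℝ≥0 n - u) * G) L
          (TopologicalSpace.denseSeq ℝ≥0 n) ω :=
    ae_all_iff.2 fun n => hZ.2 _
  have hint : ∀ᵐ ω ∂μ, ∀ n, _ := ae_all_iff.2 fun n =>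
    let t := TopologicalSpace.denseSeq ℝ≥0 n
    stochIntegral_ae_eq hL (f := fun u => expMat R (t - u) * G)
      (f' := fun u => -(R * expMat R (t - u) * G)) (fun u i j => ?_) ?_ t
  · filter_upwards [hall, hint, hL.2, hZ.1.2] with ω h1 h2 h3 h4
    refine eq_add_integral_of_variation_of_constants R G h3 h4
      (TopologicalSpace.denseRange_denseSeq ℝ≥0) ?_
    rintro _ ⟨n, rfl⟩
    rw [h1 n]
    congr 1
    exact h2 n
  · have h : ∀ k, HasDerivAt (fun u : ℝ => expMat R (t - u) i k)
        (-(R * expMat R (t - u)) i k) u := fun k => by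
      simpa using (hasDerivAt_expMat_apply R (t - u) i k).comp_const_sub (t : ℝ) u
    have hs := HasDerivAt.fun_sum (u := Finset.univ) fun k _ => (h k).mul_const (G k j)
    refine hs.congr_deriv ?_
    simp [Matrix.mul_apply (M := R * expMat R (t - u))]
  · exact ((continuous_const.matrix_mul ((continuous_expMat R).comp (by fun_prop))).matrix_mul
      continuous_const).neg

end OrnsteinUhlenbeck

/-! ## The state space model -/

lemma toC_mulVec_vecC {l n : Type*} [Fintype n] (M : Matrix l n ℝ) (v : n → ℝ) :
    (toC M).mulVec (vecC v) = vecC (M.mulVec v) := by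
  ext i
  simp [toC, vecC, Matrix.mulVec, dotProduct]

lemma clm_toC_mulVec {l n : Type*} [Fintype n] (T : ℂ →L[ℝ] ℝ) (M : Matrix l n ℝ) (v : n → ℂ)
    (i : l) : T ((toC M).mulVec v i) = M.mulVec (fun j => T (v j)) i := by
  simp only [toC, Matrix.mulVec, dotProduct, map_sum, Matrix.map_apply]
  refine Finset.sum_congr rfl fun j _ => ?_
  rw [← smul_eq_mul (a := M i j), ← T.map_smul, Complex.real_smul]

lemma IsRightSolvent.sum_mul_pow {p d : ℕ} {A : ℕ → Matrix (Fin d) (Fin d) ℝ}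
    {R : Matrix (Fin d) (Fin d) ℂ} (hR : IsRightSolvent p A R) :
    ∑ i : Fin p, -toC (A (p - i)) * R ^ (i : ℕ) = R ^ p := by
  rw [IsRightSolvent, arRightEval, add_eq_zero_iff_eq_neg] at hR
  rw [hR, ← Finset.sum_neg_distrib, Fin.sum_univ_eq_sum_range fun i => -toC (A (p - i)) * R ^ i]
  refine Finset.sum_bij' (fun i _ => p - i) (fun i _ => p - i) ?_ ?_ ?_ ?_ ?_
  · intro i hi
    rw [Finset.mem_range] at hi
    exact Finset.mem_Icc.2 ⟨by omega, by omega⟩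
  · intro i hi
    rw [Finset.mem_Icc] at hi
    exact Finset.mem_range.2 (by omega)
  · intro i hi
    rw [Finset.mem_range] at hi
    omega
  · intro i hi
    rw [Finset.mem_Icc] at hi
    omega
  · intro i hi
    rw [Finset.mem_range] at hi
    rw [show p - (p - i) = i by omega, Matrix.neg_mul]

/-- This is `A* V = V diag(R_k)`: the superdiagonal rows shift `R_k^i` to `R_k^(i+1)`, and the last
row produces `R_k^p` by the solvent equation. -/
lemma stateA_mul_blockVandermonde_apply {p d : ℕ} {A : ℕ → Matrix (Fin d) (Fin d) ℝ}
    {R : Fin p → Matrix (Fin d) (Fin d) ℂ} (hR : ∀ k, IsRightSolvent p A (R k))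
    (r c : Fin p × Fin d) :
    (toC (stateA p A) * blockVandermonde R) r c = (R c.1 ^ ((r.1 : ℕ) + 1)) r.2 c.2 := by
  rw [Matrix.mul_apply, Fintype.sum_prod_type]
  simp only [toC, stateA, blockVandermonde, Matrix.map_apply, Matrix.of_apply]
  by_cases h : (r.1 : ℕ) + 1 = p
  · rw [h, ← (hR c.1).sum_mul_pow, Matrix.sum_apply]
    refine Finset.sum_congr rfl fun i _ => ?_
    simp [Matrix.mul_apply, toC]
  · have hlt : (r.1 : ℕ) + 1 < p := lt_of_le_of_ne r.1.2 h
    rw [Finset.sum_eq_single ⟨(r.1 : ℕ) + 1, hlt⟩]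
    · simp [h, Matrix.one_apply, apply_ite (fun x : ℝ => (x : ℂ))]
    · intro i _ hi
      have hi' : (i : ℕ) ≠ (r.1 : ℕ) + 1 := fun h => hi (Fin.ext h)
      simp [h, hi']
    · exact fun h => absurd (Finset.mem_univ _) h

/-- The block vector with blocks `y k`. -/
abbrev stack {p d : ℕ} (y : Fin p → (Fin d → ℂ)) : Fin p × Fin d → ℂ := fun c => y c.1 c.2

lemma blockVandermonde_mulVec_stack_apply {p d : ℕ} (R : Fin p → Matrix (Fin d) (Fin d) ℂ)
    (y : Fin p → (Fin d → ℂ)) (r : Fin p × Fin d) :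
    (blockVandermonde R).mulVec (stack y) r = ∑ k, ((R k) ^ (r.1 : ℕ)).mulVec (y k) r.2 := by
  simp only [Matrix.mulVec, dotProduct]
  rw [Fintype.sum_prod_type]
  rfl

lemma stateA_mulVec_blockVandermonde_mulVec {p d : ℕ} {A : ℕ → Matrix (Fin d) (Fin d) ℝ}
    {R : Fin p → Matrix (Fin d) (Fin d) ℂ} (hR : ∀ k, IsRightSolvent p A (R k))
    (y : Fin p → (Fin d → ℂ)) :
    (toC (stateA p A)).mulVec ((blockVandermonde R).mulVec (stack y)) =
      (blockVandermonde R).mulVec (stack fun k => (R k).mulVec (y k)) := by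
  ext r
  rw [Matrix.mulVec_mulVec, blockVandermonde_mulVec_stack_apply]
  simp only [Matrix.mulVec_mulVec, ← pow_succ]
  simp only [Matrix.mulVec, dotProduct, stateA_mul_blockVandermonde_apply hR]
  rw [Fintype.sum_prod_type]

lemma blockVandermonde_mulVec_stack_mulVec {p q d m : ℕ} {A : ℕ → Matrix (Fin d) (Fin d) ℝ}
    {B : ℕ → Matrix (Fin d) (Fin m) ℝ} {R : Fin p → Matrix (Fin d) (Fin d) ℂ}
    {G : Fin p → Matrix (Fin d) (Fin m) ℂ}
    (hG : ∀ i < p, ∑ k, R k ^ i * G k = toC (stateBeta p q A B (i + 1))) (v : Fin m → ℂ) :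
    (blockVandermonde R).mulVec (stack fun k => (G k).mulVec v) =
      (toC (stateB p q A B)).mulVec v := by
  ext r
  rw [blockVandermonde_mulVec_stack_apply]
  simp only [Matrix.mulVec_mulVec]
  rw [← Finset.sum_apply, ← Matrix.sum_mulVec, hG _ r.1.2]
  rfl

lemma stateC_mulVec {p d : ℕ} (hp : 0 < p) (v : Fin p × Fin d → ℝ) (i : Fin d) :
    (stateC p d).mulVec v i = v (⟨0, hp⟩, i) := by
  simp only [Matrix.mulVec, dotProduct, stateC, Matrix.of_apply]
  rw [Fintype.sum_prod_type, Finset.sum_eq_single ⟨0, hp⟩]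
  · simp [Matrix.one_apply]
  · intro k _ hk
    have hk' : (k : ℕ) ≠ 0 := fun h => hk (Fin.ext h)
    simp [hk']
  · exact fun h => absurd (Finset.mem_univ _) h

section LinearEquation

variable {ι : Type*} [Fintype ι]

lemma IsCadlag.mulVec {x : ℝ≥0 → (ι → ℝ)} (hx : IsCadlag x) (M : Matrix ι ι ℝ) :
    IsCadlag fun t => M.mulVec (x t) :=
  hx.map (φ := fun _ v => M.mulVec v) (continuous_const.matrix_mulVec continuous_snd)

/-- Real-linear functionals can be applied to a linear integral equation with real coefficients. -/
lemma clm_eq_add_integral {M : Matrix ι ι ℝ} {x : ℝ≥0 → (ι → ℂ)} (hx : IsCadlag x)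
    {v : ι → ℂ} {t : ℝ≥0} (T : ℂ →L[ℝ] ℝ)
    (h : x t = x 0 + (∫ s in (0 : ℝ)..t, (toC M).mulVec (x s.toNNReal)) + v) :
    (fun i => T (x t i)) = (fun i => T (x 0 i)) +
      (∫ s in (0 : ℝ)..t, M.mulVec fun i => T (x s.toNNReal i)) + fun i => T (v i) := by
  let S : (ι → ℂ) →L[ℝ] (ι → ℝ) := ContinuousLinearMap.pi fun i => T.comp (.proj i)
  have hMx : IsCadlag fun s => (toC M).mulVec (x s) :=
    hx.map (φ := fun _ v => (toC M).mulVec v) (continuous_const.matrix_mulVec continuous_snd)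
  have hS : ∀ w, S ((toC M).mulVec w) = M.mulVec fun i => T (w i) := fun w =>
    funext fun i => clm_toC_mulVec T M w i
  have h2 := congrArg S h
  rw [map_add, map_add, ← S.intervalIntegral_comp_comm (hMx.intervalIntegrable t)] at h2
  simp_rw [hS] at h2
  exact h2

/-- The homogeneous linear integral equation has only the trivial solution. -/
lemma eq_zero_of_eq_integral {M : Matrix ι ι ℝ} {x : ℝ≥0 → (ι → ℝ)} (hx : IsCadlag x)
    (h : ∀ t : ℝ≥0, x t = ∫ s in (0 : ℝ)..t, M.mulVec (x s.toNNReal)) (t : ℝ≥0) : x t = 0 := by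
  set H : ℝ → (ι → ℝ) := fun r => ∫ s in (0 : ℝ)..r, M.mulVec (x s.toNNReal) with hH
  have hxH : ∀ t : ℝ≥0, x t = H t := h
  set S := M.mulVecLin.toContinuousLinearMap
  -- Gronwall is applied to the continuous integral `H`, which coincides with `x` and has right
  -- derivative `M H`; zero initial value and zero forcing make the bound vanish.
  have hg := norm_le_gronwallBound_of_norm_deriv_right_le (f := H) (f' := fun r => S (H r))
    (δ := 0) (K := ‖S‖) (ε := 0) (a := 0) (b := t) ((hx.mulVec M).continuousOn_integral t)
    (fun r hr => ?_) (by simp [hH]) (fun r _ => by simpa using S.le_opNorm (H r)) t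
    ⟨t.2, le_rfl⟩
  · rw [gronwallBound_ε0_δ0] at hg
    rw [hxH t]
    exact norm_le_zero_iff.1 hg
  · lift r to ℝ≥0 using hr.1
    have hd := (hx.mulVec M).hasDerivWithinAt_integral r
    rw [hxH r] at hd
    exact hd.Ici_of_Ioi

end LinearEquation

lemma ae_blockVandermonde_mulVec_eq {μ : Measure Ω} [IsProbabilityMeasure μ] {d m p q : ℕ}
    {A : ℕ → Matrix (Fin d) (Fin d) ℝ} {B : ℕ → Matrix (Fin d) (Fin m) ℝ}
    {L : ℝ≥0 → Ω → (Fin m → ℝ)} (hL : IsCadlagProcess μ L)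
    {R : Fin p → Matrix (Fin d) (Fin d) ℂ} (hR : ∀ k, IsRightSolvent p A (R k))
    {G : Fin p → Matrix (Fin d) (Fin m) ℂ}
    (hG : ∀ i < p, ∑ k, R k ^ i * G k = toC (stateBeta p q A B (i + 1)))
    {Y : Fin p → ℝ≥0 → Ω → (Fin d → ℂ)} (hY : ∀ k, IsOrnsteinUhlenbeck μ (R k) (G k) L (Y k)) :
    ∀ᵐ ω ∂μ, IsCadlag (fun t => (blockVandermonde R).mulVec (stack fun k => Y k t ω)) ∧
      ∀ t : ℝ≥0, (blockVandermonde R).mulVec (stack fun k => Y k t ω) =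
        (blockVandermonde R).mulVec (stack fun k => Y k 0 ω) +
        (∫ s in (0 : ℝ)..t, (toC (stateA p A)).mulVec
          ((blockVandermonde R).mulVec (stack fun k => Y k s.toNNReal ω))) +
        vecC ((stateB p q A B).mulVec (L t ω - L 0 ω)) := by
  filter_upwards [ae_all_iff.2 fun k => (hY k).ae_eq_add_integral hL,
    ae_all_iff.2 fun k => (hY k).1.2] with ω heq hc
  have hstack : IsCadlag fun t => stack fun k => Y k t ω := IsCadlag.pi fun c =>
    (hc c.1).map (φ := fun _ v => v c.2) (by fun_prop)
  refine ⟨hstack.map (φ := fun _ v => (blockVandermonde R).mulVec v)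
    (continuous_const.matrix_mulVec continuous_snd), fun t => ?_⟩
  have hRY : ∀ k, IsCadlag fun s => (R k).mulVec (Y k s ω) := fun k =>
    (hc k).map (φ := fun _ v => (R k).mulVec v) (continuous_const.matrix_mulVec continuous_snd)
  have hz : IsCadlag fun s => stack fun k => (R k).mulVec (Y k s ω) := IsCadlag.pi fun c =>
    (hRY c.1).map (φ := fun _ v => v c.2) (by fun_prop)
  have hint : (stack fun k => ∫ s in (0 : ℝ)..t, (R k).mulVec (Y k s.toNNReal ω)) =
      ∫ s in (0 : ℝ)..t, stack fun k => (R k).mulVec (Y k s.toNNReal ω) := by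
    ext c
    have h1 := (ContinuousLinearMap.proj (R := ℂ) (φ := fun _ : Fin d => ℂ)
      c.2).intervalIntegral_comp_comm ((hRY c.1).intervalIntegrable t)
    have h2 := (ContinuousLinearMap.proj (R := ℂ) (φ := fun _ : Fin p × Fin d => ℂ)
      c).intervalIntegral_comp_comm (hz.intervalIntegrable t)
    exact h1.symm.trans h2
  have hV := ((blockVandermonde R).mulVecLin.toContinuousLinearMap).intervalIntegral_comp_comm
    (hz.intervalIntegrable t)
  have hsplit : (stack fun k => Y k t ω) = (stack fun k => Y k 0 ω) +
      (stack fun k => ∫ s in (0 : ℝ)..t, (R k).mulVec (Y k s.toNNReal ω)) +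
      stack fun k => (G k).mulVec (vecC (L t ω) - vecC (L 0 ω)) := by
    ext c
    exact congrFun (heq c.1 t) c.2
  have hvec : vecC (L t ω) - vecC (L 0 ω) = vecC (L t ω - L 0 ω) := by
    ext j
    simp [vecC]
  rw [hsplit, Matrix.mulVec_add, Matrix.mulVec_add, blockVandermonde_mulVec_stack_mulVec hG, hint,
    hvec, toC_mulVec_vecC]
  simp_rw [stateA_mulVec_blockVandermonde_mulVec hR]
  congr 2
  exact hV.symm

end

end MCARMA

theorem mainTheorem1 {Ω : Type*} [MeasurableSpace Ω] (μ : Measure Ω) [IsProbabilityMeasure μ]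
    {d m p q : ℕ} (hqp : q < p)
    (A : ℕ → Matrix (Fin d) (Fin d) ℝ) (B : ℕ → Matrix (Fin d) (Fin m) ℝ)
    (L : ℝ≥0 → Ω → (Fin m → ℝ)) (hL : MCARMA.IsLevyProcess μ L)
    (hirr : MCARMA.LeftCoprime (MCARMA.arPoly p A) (MCARMA.maPoly q B))
    (R : Fin p → Matrix (Fin d) (Fin d) ℂ) (hR : MCARMA.IsCompleteRegularSolvents p A R)
    (Γ : Fin p → MCARMA.SimpleClosedContour)
    (hΓ : ∀ k, MCARMA.IsResidueContour (MCARMA.arPoly p A) (R k) (Γ k))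
    (Y : Fin p → ℝ≥0 → Ω → (Fin d → ℂ))
    (hY : ∀ k, MCARMA.IsOrnsteinUhlenbeck μ (R k)
      (MCARMA.residueAlong (MCARMA.ratFun (MCARMA.arPoly p A) (MCARMA.maPoly q B)) (Γ k)) L (Y k))
    (hreal : ∀ᵐ ω ∂μ, ∀ r,
      ((MCARMA.blockVandermonde R).mulVec (fun c => Y c.1 0 ω c.2) r).im = 0) :
    (∀ᵐ ω ∂μ, ∀ t i, ((∑ k, Y k t ω) i).im = 0) ∧
      MCARMA.IsMCARMA p q A B μ L (fun t ω i => ((∑ k, Y k t ω) i).re) := by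
  have hG := fun i hi => MCARMA.sum_pow_mul_residueAlong (i := i) hqp B hR hΓ hi
  have hsol := MCARMA.ae_blockVandermonde_mulVec_eq hL.cadlag (fun k => (hR.1 k).1) hG hY
  set V := MCARMA.blockVandermonde R with hV
  have hp : 0 < p := hqp.pos
  have hfirst : ∀ t ω i, (∑ k, Y k t ω) i =
      V.mulVec (MCARMA.stack fun k => Y k t ω) (⟨0, hp⟩, i) := fun t ω i => by
    rw [hV, MCARMA.blockVandermonde_mulVec_stack_apply, Finset.sum_apply]
    simp
  -- The forcing term is real, so the imaginary part of the stacked process satisfies the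
  -- homogeneous equation, starting from zero by `hreal`.
  have him : ∀ᵐ ω ∂μ, ∀ t r, (V.mulVec (MCARMA.stack fun k => Y k t ω) r).im = 0 := by
    filter_upwards [hsol, hreal] with ω hω h0 t r
    have hg : MCARMA.IsCadlag fun t r => Complex.imCLM (V.mulVec (MCARMA.stack fun k => Y k t ω) r) :=
      hω.1.map (φ := fun _ v r => Complex.imCLM (v r)) (by fun_prop)
    refine congrFun (MCARMA.eq_zero_of_eq_integral (M := MCARMA.stateA p A) hg (fun t => ?_) t) r
    refine (MCARMA.clm_eq_add_integral hω.1 Complex.imCLM (hω.2 t)).trans ?_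
    ext i
    simpa using h0 i
  refine ⟨?_, fun t ω r => (V.mulVec (MCARMA.stack fun k => Y k t ω) r).re, ⟨fun t => ?_, ?_⟩, ?_⟩
  · filter_upwards [him] with ω hω t i
    rw [hfirst]
    exact hω t _
  · refine measurable_pi_lambda _ fun r => Complex.measurable_re.comp ?_
    refine Finset.measurable_fun_sum _ fun c _ => measurable_const.mul ?_
    exact (measurable_pi_apply c.2).comp ((hY c.1).1.1 t)
  · filter_upwards [hsol] with ω hω
    exact hω.1.map (φ := fun _ v r => (v r).re) (by fun_prop)
  · filter_upwards [hsol] with ω hω t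
    refine ⟨funext fun i => ?_, ?_⟩
    · rw [MCARMA.stateC_mulVec hp, hfirst]
    · exact MCARMA.clm_eq_add_integral hω.1 Complex.reCLM (hω.2 t)
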